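/- Let $(M,g)$ be a smooth finite-dimensional Riemannian manifold with Levi-Civita connection $\nabla$ and curvature $R(X,Y)Z=\nabla_X\nabla_YZ-\nabla_Y\nabla_XZ-\nabla_{[X,Y]}Z$. Assume that $TM=A\oplus B$ is an orthogonal decomposition into smooth subbundles of ranks $a$ and $b$, and that $g$ is flat on $B$, i.e. $R(X,Y)=0$ for all $X\in B_x$, $Y\in T_xM$, $x\in M$. Let $\Omega^\bullet(M)$ be the algebra of smooth differential forms with the wedge product and the de Rham differential $d$, let $\Omega^\bullet(M,TM)$ be the smooth $TM$-valued forms with the module structure $\alpha\,(\beta\otimes X)=(\alpha\wedge\beta)\otimes X$, and let $\nabla:\Omega^\bullet(M,TM)\to\Omega^{\bullet+1}(M,TM)$ also denote the exterior covariant derivative of the Levi-Civita connection, $$(\nabla\alpha)(X_0,\dots,X_k)=\sum_i(-1)^i\,\nabla_{X_i}\bigl(\alpha(X_0,\dots,\widehat{X_i},\dots,X_k)\bigr)+\sum_{i<j}(-1)^{i+j}\alpha([X_i,X_j],X_0,\dots,\widehat{X_i},\dots,\widehat{X_j},\dots,X_k).$$ Then for every integer $N\ge 1$ with $N\ge a$,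 $(\Omega^\bullet(M,TM),\nabla)$ is a $2N$-differential graded module over $\Omega^\bullet(M)$ (this is what is meant by calling it a $2N$-dga): $d$ and $\nabla$ are well defined, $\Omega^\bullet(M,TM)$ is a graded unital (associative) module over $\Omega^\bullet(M)$, the map $\nabla$ is $\mathbb R$-linear of degree $1$ and satisfies $\nabla(\omega\wedge\alpha)=d\omega\wedge\alpha+(-1)^{\deg\omega}\,\omega\wedge\nabla\alpha$ for $\omega\in\Omega^\bullet(M)$, $\alpha\in\Omega^\bullet(M,TM)$, and $\nabla^{2N}=0$. -/

import Mathlib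

open Bundle Set
open scoped Manifold ContDiff

noncomputable section

namespace NFlat

variable {E : Type*} [NormedAddCommGroup E] [NormedSpace ℝ E]
  {H : Type*} [TopologicalSpace H] {I : ModelWithCorners ℝ E H}
  {M : Type*} [TopologicalSpace M] [ChartedSpace H M] [IsManifold I ∞ M]

/-- The vector field `X` is smooth on the set `U`. -/
def SmoothField (U : Set M) (X : Π x : M, TangentSpace I x) : Prop :=
  ContMDiffOn I (I.prod 𝓘(ℝ, E)) ∞
    (fun x ↦ (TotalSpace.mk' E x (X x) : TotalSpace E (TangentSpace I : M → Type _))) U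

section Forms

variable (I)
variable {M : Type*} [TopologicalSpace M] [ChartedSpace H M] [IsManifold I ∞ M]
  (F : Type*) [NormedAddCommGroup F] [NormedSpace ℝ F]
  (V : M → Type*) [TopologicalSpace (TotalSpace F V)]
  [∀ x, AddCommGroup (V x)] [∀ x, Module ℝ (V x)] [∀ x, TopologicalSpace (V x)]
  [FiberBundle F V] [VectorBundle ℝ F V]

/-- `Ω^k(M, V)`: the real vector space of smooth `k`-forms on `M` with values in the vector
bundle `V`. A form assigns to every point `x` an alternating `k`-linear map `T_x M → V x`; it is
smooth if, on every open set, it takes smooth vector fields to smooth sections of `V`. -/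
def VForm (k : ℕ) : Submodule ℝ (Π x : M, (TangentSpace I x) [⋀^Fin k]→ₗ[ℝ] V x) where
  carrier := {α | ∀ U : Set M, IsOpen U → ∀ X : Fin k → Π x : M, TangentSpace I x,
    (∀ i, SmoothField U (X i)) →
      ContMDiffOn I (I.prod 𝓘(ℝ, F)) ∞ (fun x ↦ TotalSpace.mk' F x (α x fun i ↦ X i x)) U}
  add_mem' := fun hα hβ U hU X hX ↦ (hα U hU X hX).add_section (hβ U hU X hX)
  zero_mem' := fun _ _ _ _ ↦ (contMDiff_zeroSection ℝ V).contMDiffOn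
  smul_mem' := fun _ _ hα U hU X hX ↦ (hα U hU X hX).const_smul_section

/-- `Ω^k(M)`: the smooth real-valued `k`-forms on `M`. -/
abbrev RForm (M : Type*) [TopologicalSpace M] [ChartedSpace H M] [IsManifold I ∞ M] (k : ℕ) :=
  VForm I ℝ (Bundle.Trivial M ℝ) k

/-- `Ω^k(M, TM)`: the smooth `k`-forms on `M` with values in the tangent bundle. -/
abbrev TForm (M : Type*) [TopologicalSpace M] [ChartedSpace H M] [IsManifold I ∞ M] (k : ℕ) :=
  VForm I E (TangentSpace I : M → Type _) k

end Forms

section Wedge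

/-- The wedge product of an alternating form and a vector-valued alternating form on a vector
space: the sum over `(k, l)`-shuffles `σ` of
`sign σ • a (v (σ 0), …, v (σ (k - 1))) • b (v (σ k), …, v (σ (k + l - 1)))`. -/
def wedgeAlt {T W : Type*} [AddCommGroup T] [Module ℝ T] [AddCommGroup W] [Module ℝ W]
    {k l : ℕ} (a : T [⋀^Fin k]→ₗ[ℝ] ℝ) (b : T [⋀^Fin l]→ₗ[ℝ] W) : T [⋀^Fin (k + l)]→ₗ[ℝ] W :=
  ((TensorProduct.lid ℝ W).toLinearMap.compAlternatingMap (a.domCoprod b)).domDomCongr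
    finSumFinEquiv

theorem wedgeAlt_add_left {T W : Type*} [AddCommGroup T] [Module ℝ T] [AddCommGroup W]
    [Module ℝ W] {k l : ℕ} (a a' : T [⋀^Fin k]→ₗ[ℝ] ℝ) (b : T [⋀^Fin l]→ₗ[ℝ] W) :
    wedgeAlt (a + a') b = wedgeAlt a b + wedgeAlt a' b := by
  ext v
  simp only [wedgeAlt, ← AlternatingMap.domCoprod'_apply, TensorProduct.add_tmul, map_add]
  simp

theorem wedgeAlt_add_right {T W : Type*} [AddCommGroup T] [Module ℝ T] [AddCommGroup W]
    [Module ℝ W] {k l : ℕ} (a : T [⋀^Fin k]→ₗ[ℝ] ℝ) (b b' : T [⋀^Fin l]→ₗ[ℝ] W) :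
    wedgeAlt a (b + b') = wedgeAlt a b + wedgeAlt a b' := by
  ext v
  simp only [wedgeAlt, ← AlternatingMap.domCoprod'_apply, TensorProduct.tmul_add, map_add]
  simp

theorem wedgeAlt_smul_left {T W : Type*} [AddCommGroup T] [Module ℝ T] [AddCommGroup W]
    [Module ℝ W] {k l : ℕ} (c : ℝ) (a : T [⋀^Fin k]→ₗ[ℝ] ℝ) (b : T [⋀^Fin l]→ₗ[ℝ] W) :
    wedgeAlt (c • a) b = c • wedgeAlt a b := by
  ext v
  simp only [wedgeAlt, ← AlternatingMap.domCoprod'_apply, ← TensorProduct.smul_tmul', map_smul]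
  simp

theorem wedgeAlt_smul_right {T W : Type*} [AddCommGroup T] [Module ℝ T] [AddCommGroup W]
    [Module ℝ W] {k l : ℕ} (c : ℝ) (a : T [⋀^Fin k]→ₗ[ℝ] ℝ) (b : T [⋀^Fin l]→ₗ[ℝ] W) :
    wedgeAlt a (c • b) = c • wedgeAlt a b := by
  ext v
  simp only [wedgeAlt, ← AlternatingMap.domCoprod'_apply, TensorProduct.tmul_smul, map_smul]
  simp

variable {F : Type*} [NormedAddCommGroup F] [NormedSpace ℝ F]
  {V : M → Type*} [TopologicalSpace (TotalSpace F V)]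
  [∀ x, AddCommGroup (V x)] [∀ x, Module ℝ (V x)] [∀ x, TopologicalSpace (V x)]
  [FiberBundle F V] [VectorBundle ℝ F V]

theorem wedgeAlt_mem {k l : ℕ} (a : RForm I M k) (α : VForm I F V l) :
    (fun x ↦ wedgeAlt (a.1 x) (α.1 x)) ∈ VForm I F V (k + l) := by
  intro U hU X hX
  have key : ∀ x, wedgeAlt (a.1 x) (α.1 x) (fun i ↦ X i x) =
      ∑ σ : Equiv.Perm.ModSumCongr (Fin k) (Fin l), TensorProduct.lid ℝ (V x)
        (AlternatingMap.domCoprod.summand (a.1 x) (α.1 x) σ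
          (fun i ↦ X (finSumFinEquiv i) x)) := by
    intro x
    simp only [wedgeAlt, AlternatingMap.domDomCongr_apply, LinearMap.compAlternatingMap_apply,
      AlternatingMap.domCoprod_apply, sum_apply, map_sum]
    rfl
  simp only [key]
  refine ContMDiffOn.sum_section fun σ _ ↦ ?_
  induction σ using Quotient.inductionOn' with
  | h σ =>
    have hs := ((a.2 U hU (fun i ↦ X (finSumFinEquiv (σ (Sum.inl i)))) fun i ↦ hX _))
    have hs' : ContMDiffOn I 𝓘(ℝ, ℝ) ∞
        (fun x ↦ (a.1 x fun i ↦ X (finSumFinEquiv (σ (Sum.inl i))) x : ℝ)) U :=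
      fun x hx ↦ contMDiffWithinAt_section.1 (hs x hx)
    have ht := α.2 U hU (fun i ↦ X (finSumFinEquiv (σ (Sum.inr i)))) fun i ↦ hX _
    have := (hs'.smul_section ht).const_smul_section (a := ((Equiv.Perm.sign σ : ℤ) : ℝ))
    refine this.congr fun x _ ↦ ?_
    rcases Int.units_eq_one_or (Equiv.Perm.sign σ) with h | h <;>
      simp [AlternatingMap.domCoprod.summand_mk'', h]

/-- The product `Ω^k(M) × Ω^l(M, V) → Ω^{k+l}(M, V)`, as a bilinear map. -/
def wedge {k l : ℕ} : RForm I M k →ₗ[ℝ] VForm I F V l →ₗ[ℝ] VForm I F V (k + l) :=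
  LinearMap.mk₂ ℝ (fun a α ↦ ⟨fun x ↦ wedgeAlt (a.1 x) (α.1 x), wedgeAlt_mem a α⟩)
    (fun a a' α ↦ Subtype.ext <| funext fun x ↦ wedgeAlt_add_left (a.1 x) (a'.1 x) (α.1 x))
    (fun c a α ↦ Subtype.ext <| funext fun x ↦ wedgeAlt_smul_left c (a.1 x) (α.1 x))
    (fun a α α' ↦ Subtype.ext <| funext fun x ↦ wedgeAlt_add_right (a.1 x) (α.1 x) (α'.1 x))
    (fun c a α ↦ Subtype.ext <| funext fun x ↦ wedgeAlt_smul_right c (a.1 x) (α.1 x))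

/-- The constant function `1`, as a smooth `0`-form. -/
def oneForm : RForm I M 0 :=
  ⟨fun _ ↦ AlternatingMap.constOfIsEmpty ℝ _ (Fin 0) (1 : ℝ), fun _ _ _ _ _ _ ↦
    contMDiffWithinAt_section.2 (contMDiffWithinAt_const (c := (1 : ℝ)))⟩

end Wedge

section Derivatives

variable {F : Type*} [NormedAddCommGroup F] [NormedSpace ℝ F]
  {V : M → Type*} [TopologicalSpace (TotalSpace F V)]
  [∀ x, AddCommGroup (V x)] [∀ x, Module ℝ (V x)] [∀ x, TopologicalSpace (V x)]
  [FiberBundle F V] [VectorBundle ℝ F V]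

/-- `D` is the exterior covariant derivative of the covariant derivative `nab` on `V`: for smooth
vector fields `X_0, …, X_k` on an open set, `(D α)(X_0, …, X_k)` is
`∑_i (-1)^i ∇_{X_i} (α(X_0, …, X̂_i, …, X_k))
  + ∑_{i < j} (-1)^{i + j} α([X_i, X_j], X_0, …, X̂_i, …, X̂_j, …, X_k)`.
In the second sum the bracket is moved from the first place to the place of `X_j`, which turns the
sign `(-1)^{i + j}` into `-(-1)^i` and gives a formula that also makes sense for `k = 0`; the
index `j` of `X_j` is `i.succAbove m`. -/
def IsExteriorCovariantDerivative
    (nab : (Π x : M, V x) → (Π x : M, TangentSpace I x →L[ℝ] V x))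
    (D : ∀ k, VForm I F V k →ₗ[ℝ] VForm I F V (k + 1)) : Prop :=
  ∀ (k : ℕ) (α : VForm I F V k) (U : Set M), IsOpen U →
    ∀ X : Fin (k + 1) → Π x : M, TangentSpace I x, (∀ i, SmoothField U (X i)) →
      ∀ x ∈ U, (D k α).1 x (fun i ↦ X i x) =
        ∑ i : Fin (k + 1), (-1 : ℝ) ^ (i : ℕ) •
          (nab (fun y ↦ α.1 y fun m ↦ X (i.succAbove m) y) x (X i x) -
            ∑ m : Fin k with i < i.succAbove m,
              α.1 x (Function.update (fun m' ↦ X (i.succAbove m') x) m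
                (VectorField.mlieBracket I (X i) (X (i.succAbove m)) x)))

/-- `d` is the de Rham differential on `Ω(M)`: the exterior covariant derivative of the usual
derivative of functions. -/
def IsDeRhamDifferential (d : ∀ k, RForm I M k →ₗ[ℝ] RForm I M (k + 1)) : Prop :=
  IsExteriorCovariantDerivative (F := ℝ) (V := Bundle.Trivial M ℝ)
    (fun (f : M → ℝ) x ↦ mfderiv I 𝓘(ℝ, ℝ) f x) d

/-- The iterate `D^m : Ω^k(M, V) → Ω^{k+m}(M, V)` of a map `D` of degree one. -/
def iter (D : ∀ k, VForm I F V k →ₗ[ℝ] VForm I F V (k + 1)) (k : ℕ) :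
    ∀ m, VForm I F V k →ₗ[ℝ] VForm I F V (k + m)
  | 0 => LinearMap.id
  | m + 1 => D (k + m) ∘ₗ iter D k m

/-- `(Ω(M, V), D)` is an `N`-differential graded module over the algebra `Ω(M)` with the
differential `d`: the product makes `Ω(M, V)` a graded unital module over `Ω(M)`, the degree-one
linear map `D` satisfies the graded Leibniz rule, and `D^N = 0`. -/
structure IsNDGModule (d : ∀ k, RForm I M k →ₗ[ℝ] RForm I M (k + 1))
    (D : ∀ k, VForm I F V k →ₗ[ℝ] VForm I F V (k + 1)) (N : ℕ) : Prop where
  one_wedge : ∀ (l : ℕ) (α : VForm I F V l) (x : M),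
    (wedge (oneForm : RForm I M 0) α).1 x = (α.1 x).domDomCongr (finCongr (Nat.zero_add l).symm)
  wedge_assoc : ∀ (j k l : ℕ) (a : RForm I M j) (b : RForm I M k) (α : VForm I F V l) (x : M),
    (wedge a (wedge b α)).1 x =
      ((wedge (wedge a b : RForm I M (j + k)) α).1 x).domDomCongr (finCongr (Nat.add_assoc j k l))
  leibniz : ∀ (k l : ℕ) (a : RForm I M k) (α : VForm I F V l) (x : M),
    (D (k + l) (wedge a α)).1 x =
      ((wedge (d k a) α).1 x).domDomCongr (finCongr (Nat.add_right_comm k 1 l)) +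
        (-1 : ℝ) ^ k • (wedge a (D l α)).1 x
  pow_eq_zero : ∀ k, iter D k N = 0

end Derivatives

section Geometry

/-- The curvature `R(X, Y) Z = ∇_X ∇_Y Z - ∇_Y ∇_X Z - ∇_{[X, Y]} Z` of a connection on `TM`. -/
def curvature (cov : CovariantDerivative I E (TangentSpace I : M → Type _))
    (X Y Z : Π x : M, TangentSpace I x) (x : M) : TangentSpace I x :=
  cov (fun y ↦ cov Z y (Y y)) x (X x) - cov (fun y ↦ cov Z y (X y)) x (Y x) -
    cov Z x (VectorField.mlieBracket I X Y x)

/-- The metric with Levi-Civita connection `cov` is flat on the distribution `B`: the curvature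
`R(X, Y)` vanishes at every point where one of the vectors `X`, `Y` (hence, `R` being
skew-symmetric in them, without restriction the first one) lies in `B`. -/
def IsFlatOn (cov : CovariantDerivative I E (TangentSpace I : M → Type _))
    (B : ∀ x : M, Submodule ℝ (TangentSpace I x)) : Prop :=
  ∀ (U : Set M), IsOpen U → ∀ X Y Z : Π x : M, TangentSpace I x,
    SmoothField U X → SmoothField U Y → SmoothField U Z →
      ∀ x ∈ U, X x ∈ B x → curvature cov X Y Z x = 0

/-- `A` is a smooth subbundle of rank `a` of the tangent bundle: locally it has a frame that
consists of `a` smooth vector fields. -/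
def IsSmoothSubbundle (A : ∀ x : M, Submodule ℝ (TangentSpace I x)) (a : ℕ) : Prop :=
  ∀ x : M, ∃ U : Set M, IsOpen U ∧ x ∈ U ∧ ∃ s : Fin a → Π y : M, TangentSpace I y,
    (∀ i, SmoothField U (s i)) ∧
      ∀ y ∈ U, LinearIndependent ℝ (fun i ↦ s i y) ∧
        Submodule.span ℝ (Set.range fun i ↦ s i y) = A y

/-- `cov` is the Levi-Civita connection of the Riemannian metric `g`: it is compatible with the
metric, `u (g(Y, Z)) = g(∇_u Y, Z) + g(Y, ∇_u Z)`, and torsion-free. -/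
def IsLeviCivita [FiniteDimensional ℝ E]
    (g : ContMDiffRiemannianMetric I ∞ E (TangentSpace I : M → Type _))
    (cov : CovariantDerivative I E (TangentSpace I : M → Type _)) : Prop :=
  (∀ (x : M) (Y Z : Π y : M, TangentSpace I y),
    MDifferentiableAt I (I.prod 𝓘(ℝ, E))
      (fun y ↦ (TotalSpace.mk' E y (Y y) : TotalSpace E (TangentSpace I : M → Type _))) x →
    MDifferentiableAt I (I.prod 𝓘(ℝ, E))
      (fun y ↦ (TotalSpace.mk' E y (Z y) : TotalSpace E (TangentSpace I : M → Type _))) x →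
    ∀ u : TangentSpace I x,
      (mfderiv I 𝓘(ℝ, ℝ) (fun y ↦ g.inner y (Y y) (Z y)) x u : ℝ) =
        g.inner x (cov Y x u) (Z x) + g.inner x (Y x) (cov Z x u)) ∧
  cov.torsion = 0

end Geometry

end NFlat

end

/-!
# The exterior covariant derivative of a metric that is flat on a distribution

The square of the exterior covariant derivative `D` is the wedge product with the curvature. If the
metric is flat on `B`, the curvature `R(X, Y)` vanishes as soon as one of `X`, `Y` lies in `B`, so
that in `D² α (X_0, …, X_{k+1}) = ∑ ± R(X_i, X_j) α(…)` only pairs of arguments outside `B` matter.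
Hence, if `α` vanishes whenever fewer than `m` of its arguments lie outside `B` (`VanishesBelow`),
then `D² α` vanishes whenever fewer than `m + 2` do
(`VanishesBelow.exteriorDeriv_exteriorDeriv`). Thus `D^{2N} α` vanishes unless at least `2 N` of its
arguments lie outside `B`. On a basis of the tangent space that is adapted to `TM = A ⊕ B` there are
only `a < 2 N` such arguments, and a form that vanishes on the distinct elements of a basis is zero
(`VanishesBelow.eq_zero`).

The curvature term is evaluated on coordinate vector fields, so that all brackets vanish and
`D² α` becomes an alternating double sum of second derivatives. For a pair of fields outside `B` the
remaining value `α(…)` vanishes at the given point only, and one needs that `R(X, Y) Z` vanishes at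
points where `Z` does; as the zero vector lies in `B`, this follows from flatness and the first
Bianchi identity (`IsFlatOn.curvature_eq_zero`).

Both `d` and `D` exist, and are unique, for the same reason. The defining formula can be rewritten
with a torsion-free connection on the tangent bundle (`exteriorFormula_eq_sum_covDeriv`), and in
this form it is tensorial in the fields, so that it equals at each point the antisymmetrisation of
the derivative of `α` along coordinate fields (`alternatizeUncurryFin_coordDeriv`). It yields smooth
forms because the connection takes smooth sections to smooth sections; for the Levi-Civita
connection this is a consequence of the Koszul formula (`IsLeviCivita.isSmoothConnection`). The same
pointwise description reduces the Leibniz rule to the fact that the coordinate derivative is a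
derivation of the wedge product and to the algebra of antisymmetrisations
(`alternatizeUncurryFin_wedgeAlt`), for which the wedge product is written as a sum over all
permutations.
-/

noncomputable section

set_option linter.unusedSectionVars false

namespace NFlat

/-! ### Antisymmetrisation and the wedge product -/

section Antisymmetrisation

open Equiv

variable {T W : Type*} [AddCommGroup W] [Module ℝ W]
  {ι κ : Type*} [Fintype ι] [DecidableEq ι] [Fintype κ] [DecidableEq κ]

/-- The antisymmetrisation `v ↦ ∑ σ, sign σ • G (v ∘ σ)` of a function `G` of `ι`-tuples, without
a normalising factor. Working with plain functions instead of multilinear maps keeps changes of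
the index type painless. -/
def altSum (G : (ι → T) → W) (v : ι → T) : W :=
  ∑ σ : Perm ι, ((Perm.sign σ : ℤ) : ℝ) • G (v ∘ σ)

theorem sign_mul_self (σ : Perm ι) :
    ((Perm.sign σ : ℤ) : ℝ) * ((Perm.sign σ : ℤ) : ℝ) = 1 := by
  rcases Int.units_eq_one_or (Perm.sign σ) with h | h <;> simp [h]

theorem altSum_comp_perm (G : (ι → T) → W) (τ : Perm ι) (v : ι → T) :
    altSum (fun w ↦ G (w ∘ τ)) v = ((Perm.sign τ : ℤ) : ℝ) • altSum G v := by
  unfold altSum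
  rw [Finset.smul_sum, ← Equiv.sum_comp (Equiv.mulRight τ)
    (fun σ : Perm ι ↦ ((Perm.sign τ : ℤ) : ℝ) • ((Perm.sign σ : ℤ) : ℝ) • G (v ∘ σ))]
  refine Finset.sum_congr rfl fun σ _ ↦ ?_
  have h := sign_mul_self τ
  simp only [Equiv.coe_mulRight, Perm.sign_mul, Units.val_mul, Int.cast_mul, smul_smul,
    Function.comp_assoc, Perm.coe_mul]
  congr 1
  linear_combination (-((Perm.sign σ : ℤ) : ℝ)) * h

theorem altSum_comp_equiv (G : (κ → T) → W) (e : κ ≃ ι) (v : ι → T) :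
    altSum (fun w ↦ G (w ∘ e)) v = altSum G (v ∘ e) := by
  unfold altSum
  rw [← Equiv.sum_comp (Equiv.permCongr e)]
  refine Finset.sum_congr rfl fun σ _ ↦ ?_
  rw [Perm.sign_permCongr]
  refine congrArg _ (congrArg G ?_)
  funext i
  simp [Equiv.permCongr_apply]

theorem altSum_add (G G' : (ι → T) → W) (v : ι → T) :
    altSum (fun w ↦ G w + G' w) v = altSum G v + altSum G' v := by
  simp [altSum, smul_add, Finset.sum_add_distrib]

theorem altSum_smul (c : ℝ) (G : (ι → T) → W) (v : ι → T) :
    altSum (fun w ↦ c • G w) v = c • altSum G v := by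
  simp only [altSum, Finset.smul_sum, smul_comm c]

theorem altSum_sum {S : Type*} (s : Finset S) (G : S → (ι → T) → W) (v : ι → T) :
    altSum (fun w ↦ ∑ i ∈ s, G i w) v = ∑ i ∈ s, altSum (G i) v := by
  simp only [altSum, Finset.smul_sum]
  exact Finset.sum_comm

theorem altSum_alternatingMap [AddCommGroup T] [Module ℝ T] (α : T [⋀^ι]→ₗ[ℝ] W) (v : ι → T) :
    altSum α v = ((Fintype.card ι).factorial : ℝ) • α v := by
  have h : ∀ σ : Perm ι, ((Perm.sign σ : ℤ) : ℝ) • α (v ∘ σ) = α v := by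
    intro σ
    rw [α.map_perm]
    rcases Int.units_eq_one_or (Perm.sign σ) with h | h <;> simp [h]
  simp only [altSum, h, Finset.sum_const, Finset.card_univ, Fintype.card_perm,
    Nat.cast_smul_eq_nsmul]

/-- Antisymmetrising first in a group of the arguments, on which the permutations act through
`h`, changes the antisymmetrisation only by the order of the group. -/
theorem altSum_altSum (h : Perm κ → Perm ι) (hs : ∀ τ, Perm.sign (h τ) = Perm.sign τ)
    (K : (ι → T) → W) (v : ι → T) :
    altSum (fun w ↦ ∑ τ : Perm κ, ((Perm.sign τ : ℤ) : ℝ) • K (w ∘ h τ)) v =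
      ((Fintype.card κ).factorial : ℝ) • altSum K v := by
  rw [altSum_sum]
  simp only [altSum_smul, altSum_comp_perm, hs, smul_smul, sign_mul_self, one_smul,
    Finset.sum_const, Finset.card_univ, Fintype.card_perm, Nat.cast_smul_eq_nsmul]

/-- Extension of a permutation of the first `k` indices by the identity. -/
def permLeft (k l : ℕ) (σ : Perm (Fin k)) : Perm (Fin (k + l)) :=
  finSumFinEquiv.permCongr (Perm.sumCongr σ 1)

/-- Extension of a permutation of the last `l` indices by the identity. -/
def permRight (k l : ℕ) (σ : Perm (Fin l)) : Perm (Fin (k + l)) :=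
  finSumFinEquiv.permCongr (Perm.sumCongr 1 σ)

theorem sign_permLeft (k l : ℕ) (σ : Perm (Fin k)) : Perm.sign (permLeft k l σ) = Perm.sign σ := by
  simp [permLeft]

theorem sign_permRight (k l : ℕ) (σ : Perm (Fin l)) :
    Perm.sign (permRight k l σ) = Perm.sign σ := by
  simp [permRight]

theorem permLeft_castAdd {k l : ℕ} (σ : Perm (Fin k)) :
    permLeft k l σ ∘ Fin.castAdd l = Fin.castAdd l ∘ σ := by
  ext i; simp [permLeft, Equiv.permCongr_apply]

theorem permLeft_natAdd {k l : ℕ} (σ : Perm (Fin k)) :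
    permLeft k l σ ∘ Fin.natAdd k = Fin.natAdd k := by
  ext i; simp [permLeft, Equiv.permCongr_apply]

theorem permRight_castAdd {k l : ℕ} (σ : Perm (Fin l)) :
    permRight k l σ ∘ Fin.castAdd l = Fin.castAdd l := by
  ext i; simp [permRight, Equiv.permCongr_apply]

theorem permRight_natAdd {k l : ℕ} (σ : Perm (Fin l)) :
    permRight k l σ ∘ Fin.natAdd k = Fin.natAdd k ∘ σ := by
  ext i; simp [permRight, Equiv.permCongr_apply]

theorem altSum_altSum_left {k l : ℕ} (G : (Fin k → T) → ℝ) (b : (Fin l → T) → W)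
    (v : Fin (k + l) → T) :
    altSum (fun w : Fin (k + l) → T ↦ altSum G (w ∘ Fin.castAdd l) • b (w ∘ Fin.natAdd k)) v =
      (k.factorial : ℝ) •
        altSum (fun w : Fin (k + l) → T ↦ G (w ∘ Fin.castAdd l) • b (w ∘ Fin.natAdd k)) v := by
  have := altSum_altSum (permLeft k l) (sign_permLeft k l)
    (fun w : Fin (k + l) → T ↦ G (w ∘ Fin.castAdd l) • b (w ∘ Fin.natAdd k)) v
  rw [Fintype.card_fin] at this
  rw [← this]
  congr 1
  funext w
  simp only [altSum, Finset.sum_smul, Function.comp_assoc, permLeft_castAdd, permLeft_natAdd,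
    smul_assoc]

theorem altSum_altSum_right {k l : ℕ} (a : (Fin k → T) → ℝ) (G : (Fin l → T) → W)
    (v : Fin (k + l) → T) :
    altSum (fun w : Fin (k + l) → T ↦ a (w ∘ Fin.castAdd l) • altSum G (w ∘ Fin.natAdd k)) v =
      (l.factorial : ℝ) •
        altSum (fun w : Fin (k + l) → T ↦ a (w ∘ Fin.castAdd l) • G (w ∘ Fin.natAdd k)) v := by
  have := altSum_altSum (permRight k l) (sign_permRight k l)
    (fun w : Fin (k + l) → T ↦ a (w ∘ Fin.castAdd l) • G (w ∘ Fin.natAdd k)) v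
  rw [Fintype.card_fin] at this
  rw [← this]
  congr 1
  funext w
  simp only [altSum, Finset.smul_sum, Function.comp_assoc, permRight_castAdd, permRight_natAdd]
  exact Finset.sum_congr rfl fun σ _ ↦ smul_comm _ _ _

theorem altSum_altSum_tail {n : ℕ} (K : T → (Fin n → T) → W) (v : Fin (n + 1) → T) :
    altSum (fun w : Fin (n + 1) → T ↦ altSum (K (w 0)) (Fin.tail w)) v =
      (n.factorial : ℝ) • altSum (fun w : Fin (n + 1) → T ↦ K (w 0) (Fin.tail w)) v := by
  have := altSum_altSum (fun τ : Perm (Fin n) ↦ Equiv.Perm.decomposeFin.symm (0, τ))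
    (fun τ ↦ by simp) (fun w : Fin (n + 1) → T ↦ K (w 0) (Fin.tail w)) v
  rw [Fintype.card_fin] at this
  rw [← this]
  refine congrArg (altSum · v) (funext fun w ↦ Finset.sum_congr rfl fun τ _ ↦ ?_)
  have h : Fin.tail (w ∘ Equiv.Perm.decomposeFin.symm (0, τ)) = Fin.tail w ∘ τ := by
    funext i
    simp [Fin.tail]
  simp [h]

end Antisymmetrisation

section WedgeAlgebra

open Equiv

variable {T W : Type*} [AddCommGroup T] [Module ℝ T] [AddCommGroup W] [Module ℝ W]

theorem factorial_smul_wedgeAlt {k l : ℕ} (a : T [⋀^Fin k]→ₗ[ℝ] ℝ) (b : T [⋀^Fin l]→ₗ[ℝ] W)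
    (v : Fin (k + l) → T) :
    ((k.factorial : ℝ) * (l.factorial : ℝ)) • wedgeAlt a b v =
      altSum (fun w : Fin (k + l) → T ↦ a (w ∘ Fin.castAdd l) • b (w ∘ Fin.natAdd k)) v := by
  have h := congrArg (fun f ↦ TensorProduct.lid ℝ W (f (v ∘ finSumFinEquiv)))
    (MultilinearMap.domCoprod_alternization_eq a b)
  simp only [MultilinearMap.alternatization_apply, AlternatingMap.smul_apply, Fintype.card_fin,
    map_sum, map_nsmul] at h
  rw [show wedgeAlt a b v = TensorProduct.lid ℝ W (a.domCoprod b (v ∘ finSumFinEquiv)) from rfl]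
  rw [← Nat.cast_mul, Nat.cast_smul_eq_nsmul, ← h]
  have h2 : (fun w : Fin (k + l) → T ↦ a (w ∘ Fin.castAdd l) • b (w ∘ Fin.natAdd k)) =
      fun w ↦ (fun u : Fin k ⊕ Fin l → T ↦ a (u ∘ Sum.inl) • b (u ∘ Sum.inr))
        (w ∘ finSumFinEquiv) := by
    funext w
    congr 2
  rw [h2, altSum_comp_equiv (fun u : Fin k ⊕ Fin l → T ↦ a (u ∘ Sum.inl) • b (u ∘ Sum.inr))]
  refine Finset.sum_congr rfl fun σ _ ↦ ?_
  rcases Int.units_eq_one_or (Perm.sign σ) with h | h <;>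
    simp [h, MultilinearMap.domCoprod_apply] <;> rfl

theorem wedgeAlt_apply {k l : ℕ} (a : T [⋀^Fin k]→ₗ[ℝ] ℝ) (b : T [⋀^Fin l]→ₗ[ℝ] W)
    (v : Fin (k + l) → T) :
    wedgeAlt a b v = ((k.factorial : ℝ) * (l.factorial : ℝ))⁻¹ •
      altSum (fun w : Fin (k + l) → T ↦ a (w ∘ Fin.castAdd l) • b (w ∘ Fin.natAdd k)) v := by
  rw [← factorial_smul_wedgeAlt, smul_smul, inv_mul_cancel₀, one_smul]
  positivity

theorem wedgeAlt_constOfIsEmpty {l : ℕ} (b : T [⋀^Fin l]→ₗ[ℝ] W) :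
    wedgeAlt (AlternatingMap.constOfIsEmpty ℝ T (Fin 0) (1 : ℝ)) b =
      b.domDomCongr (finCongr (Nat.zero_add l).symm) := by
  ext v
  have h : (fun w : Fin (0 + l) → T ↦ (AlternatingMap.constOfIsEmpty ℝ T (Fin 0) (1 : ℝ))
      (w ∘ Fin.castAdd l) • b (w ∘ Fin.natAdd 0)) =
      fun w ↦ b (w ∘ finCongr (Nat.zero_add l).symm) := by
    funext w
    simp only [AlternatingMap.constOfIsEmpty_apply, Function.const_apply, one_smul]
    congr 2
    ext i
    simp
  rw [wedgeAlt_apply, h, altSum_comp_equiv, altSum_alternatingMap, smul_smul, Fintype.card_fin]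
  simp only [Nat.factorial_zero, Nat.cast_one, one_mul]
  rw [inv_mul_cancel₀ (by positivity), one_smul]
  rfl

theorem wedgeAlt_assoc {j k l : ℕ} (a : T [⋀^Fin j]→ₗ[ℝ] ℝ) (b : T [⋀^Fin k]→ₗ[ℝ] ℝ)
    (c : T [⋀^Fin l]→ₗ[ℝ] W) :
    wedgeAlt a (wedgeAlt b c) =
      (wedgeAlt (wedgeAlt a b) c).domDomCongr (finCongr (Nat.add_assoc j k l)) := by
  ext v
  rw [AlternatingMap.domDomCongr_apply, wedgeAlt_apply, wedgeAlt_apply]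
  simp only [wedgeAlt_apply b c, wedgeAlt_apply a b]
  simp only [smul_comm (a _), smul_assoc]
  rw [altSum_smul, altSum_smul, altSum_altSum_left, altSum_altSum_right]
  rw [← altSum_comp_equiv _ (finCongr (Nat.add_assoc j k l))]
  simp only [smul_smul]
  congr 1
  · have h1 : (j.factorial : ℝ) ≠ 0 := by positivity
    have h2 : (k.factorial : ℝ) ≠ 0 := by positivity
    have h3 : (l.factorial : ℝ) ≠ 0 := by positivity
    have h4 : ((j + k).factorial : ℝ) ≠ 0 := by positivity
    have h5 : ((k + l).factorial : ℝ) ≠ 0 := by positivity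
    field_simp
  · congr 1
    funext w
    simp only [Function.comp_def]
    congr 2
    funext i
    congr 1
    ext
    simp [Nat.add_assoc]

open AlternatingMap in
theorem factorial_smul_alternatizeUncurryFin {k : ℕ} (f : T →ₗ[ℝ] T [⋀^Fin k]→ₗ[ℝ] W)
    (v : Fin (k + 1) → T) :
    (k.factorial : ℝ) • alternatizeUncurryFin f v =
      altSum (fun w : Fin (k + 1) → T ↦ f (w 0) (Fin.tail w)) v := by
  obtain ⟨K, hK⟩ : ∃ K : (Fin (k + 1) → T) → W, K = fun u ↦ f (u 0) (Fin.tail u) := ⟨_, rfl⟩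
  have h1 : ∀ w : Fin (k + 1) → T, alternatizeUncurryFin f w =
      ∑ p : Fin (k + 1), ((Perm.sign p.cycleRange.symm : ℤ) : ℝ) • K (w ∘ p.cycleRange.symm) := by
    intro w
    rw [alternatizeUncurryFin_apply, hK]
    refine Finset.sum_congr rfl fun p _ ↦ ?_
    have h2 : Fin.tail (w ∘ p.cycleRange.symm) = p.removeNth w := by
      funext i
      simp [Fin.tail, Fin.removeNth]
    simp only [h2, Function.comp_apply, Fin.cycleRange_symm_zero, Perm.sign_symm,
      Fin.sign_cycleRange]
    rcases Nat.even_or_odd (p : ℕ) with h | h <;> simp [h.neg_one_pow]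
  have h3 := altSum_alternatingMap (alternatizeUncurryFin f) v
  rw [show ⇑(alternatizeUncurryFin f) = _ from funext h1, altSum_sum] at h3
  simp only [altSum_smul, altSum_comp_perm, smul_smul, sign_mul_self, one_smul,
    Finset.sum_const, Finset.card_univ, Fintype.card_fin] at h3
  rw [Nat.factorial_succ, Nat.cast_mul, mul_smul, ← Nat.cast_smul_eq_nsmul ℝ, ← h1] at h3
  rw [← hK]
  exact (smul_right_injective W (r := ((k + 1 : ℕ) : ℝ)) (by positivity) h3).symm

theorem alternatizeUncurryFin_apply_eq_altSum {k : ℕ} (f : T →ₗ[ℝ] T [⋀^Fin k]→ₗ[ℝ] W)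
    (v : Fin (k + 1) → T) :
    AlternatingMap.alternatizeUncurryFin f v =
      (k.factorial : ℝ)⁻¹ • altSum (fun w : Fin (k + 1) → T ↦ f (w 0) (Fin.tail w)) v := by
  rw [← factorial_smul_alternatizeUncurryFin, smul_smul, inv_mul_cancel₀, one_smul]
  positivity

/-- The algebra behind the graded Leibniz rule: antisymmetrising a derivation of `a ∧ b` gives
`(D a) ∧ b + (-1)^k a ∧ D b`, where `D` stands for the antisymmetrised derivation. -/
theorem alternatizeUncurryFin_wedgeAlt {k l : ℕ} (a : T [⋀^Fin k]→ₗ[ℝ] ℝ)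
    (b : T [⋀^Fin l]→ₗ[ℝ] W) (φ : T →ₗ[ℝ] T [⋀^Fin k]→ₗ[ℝ] ℝ)
    (ψ : T →ₗ[ℝ] T [⋀^Fin l]→ₗ[ℝ] W) (f : T →ₗ[ℝ] T [⋀^Fin (k + l)]→ₗ[ℝ] W)
    (hf : ∀ v, f v = wedgeAlt (φ v) b + wedgeAlt a (ψ v)) :
    AlternatingMap.alternatizeUncurryFin f =
      (wedgeAlt (AlternatingMap.alternatizeUncurryFin φ) b).domDomCongr
          (finCongr (Nat.add_right_comm k 1 l)) +
        (-1 : ℝ) ^ k • wedgeAlt a (AlternatingMap.alternatizeUncurryFin ψ) := by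
  have hk : (k.factorial : ℝ) ≠ 0 := by positivity
  have hl : (l.factorial : ℝ) ≠ 0 := by positivity
  have hk' : ((k + 1).factorial : ℝ) ≠ 0 := by positivity
  have hl' : ((l + 1).factorial : ℝ) ≠ 0 := by positivity
  have hkl : ((k + l).factorial : ℝ) ≠ 0 := by positivity
  ext v
  rw [alternatizeUncurryFin_apply_eq_altSum]
  simp only [hf, AlternatingMap.add_apply, altSum_add, smul_add, AlternatingMap.smul_apply,
    AlternatingMap.domDomCongr_apply]
  congr 1
  · simp only [wedgeAlt_apply, alternatizeUncurryFin_apply_eq_altSum, smul_assoc, altSum_smul]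
    rw [altSum_altSum_left, altSum_altSum_tail (fun t (u : Fin (k + l) → T) ↦
      φ t (u ∘ Fin.castAdd l) • b (u ∘ Fin.natAdd k)),
      ← altSum_comp_equiv _ (finCongr (Nat.add_right_comm k 1 l))]
    simp only [smul_smul]
    congr 1
    · field_simp
    · congr 1
      funext w
      have h1 : Fin.tail w ∘ Fin.castAdd l = Fin.tail ((w ∘ finCongr
          (Nat.add_right_comm k 1 l)) ∘ Fin.castAdd l) := by
        funext i
        simp only [Function.comp_apply, Fin.tail]
        congr 1
      have h2 : Fin.tail w ∘ Fin.natAdd k = (w ∘ finCongr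
          (Nat.add_right_comm k 1 l)) ∘ Fin.natAdd (k + 1) := by
        funext i
        simp only [Function.comp_apply, Fin.tail]
        congr 1
        ext
        simp [Nat.add_right_comm]
      rw [h1, h2]
      rfl
  · simp only [wedgeAlt_apply, alternatizeUncurryFin_apply_eq_altSum, smul_comm (a _),
      altSum_smul]
    rw [altSum_altSum_right, altSum_altSum_tail (fun t (u : Fin (k + l) → T) ↦
      a (u ∘ Fin.castAdd l) • ψ t (u ∘ Fin.natAdd k))]
    let p : Fin (k + l + 1) := ⟨k, by omega⟩
    have h : (fun w : Fin (k + l + 1) → T ↦ a (w ∘ Fin.castAdd (l + 1)) •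
        ψ ((w ∘ Fin.natAdd (m := l + 1) k) 0) (Fin.tail (w ∘ Fin.natAdd (m := l + 1) k))) =
        fun w ↦ (fun u : Fin (k + l + 1) → T ↦ a (Fin.tail u ∘ Fin.castAdd l) •
          ψ (u 0) (Fin.tail u ∘ Fin.natAdd k)) (w ∘ p.cycleRange.symm) := by
      funext w
      congr 1
      · congr 1
        funext i
        simp only [Function.comp_apply, Fin.tail, Fin.cycleRange_symm_succ]
        congr 1
        rw [Fin.succAbove_of_castSucc_lt _ _ (by simp [p, Fin.lt_def])]
        rfl
      · congr 2
        · simp only [Function.comp_apply, Fin.cycleRange_symm_zero]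
          rfl
        · funext i
          simp only [Function.comp_apply, Fin.tail, Fin.cycleRange_symm_succ]
          congr 1
          rw [Fin.succAbove_of_le_castSucc _ _ (by simp [p, Fin.le_def])]
          rfl
    have h1 : altSum (fun w : Fin (k + (l + 1)) → T ↦ a (w ∘ Fin.castAdd (l + 1)) •
        ψ ((w ∘ Fin.natAdd k) 0) (Fin.tail (w ∘ Fin.natAdd k))) v =
        ((Perm.sign p.cycleRange.symm : ℤ) : ℝ) • altSum (fun u : Fin (k + l + 1) → T ↦
          a (Fin.tail u ∘ Fin.castAdd l) • ψ (u 0) (Fin.tail u ∘ Fin.natAdd k)) v :=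
      (congrArg (fun G ↦ altSum (ι := Fin (k + l + 1)) G v) h).trans
        (altSum_comp_perm (fun u : Fin (k + l + 1) → T ↦
          a (Fin.tail u ∘ Fin.castAdd l) • ψ (u 0) (Fin.tail u ∘ Fin.natAdd k))
          p.cycleRange.symm v)
    rw [h1]
    simp only [Perm.sign_symm, Fin.sign_cycleRange, smul_smul]
    congr 1
    have h2 : (-1 : ℝ) ^ k * (-1) ^ k = 1 := by rw [← mul_pow]; simp
    simp only [p, Units.val_pow_eq_pow_val, Units.val_neg, Units.val_one, Int.cast_pow,
      Int.cast_neg, Int.cast_one]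
    field_simp
    linear_combination (-1 : ℝ) * h2

end WedgeAlgebra

/-! ### Alternating sums over pairs of indices -/

section PairSums

variable {T W : Type*} [AddCommGroup T] [Module ℝ T] [AddCommGroup W] [Module ℝ W]

theorem castSucc_succAbove_of_le {k : ℕ} {i j : Fin k} (h : i ≤ j) :
    i.castSucc.succAbove j = j.succ := by
  simp [Fin.succAbove_of_le_castSucc, h]

theorem succ_succAbove_of_le {k : ℕ} {i j : Fin k} (h : i ≤ j) :
    j.succ.succAbove i = i.castSucc := by
  simp [Fin.succAbove_of_castSucc_lt, h]

theorem castSucc_succAbove_succAbove {k : ℕ} {i j : Fin (k + 1)} (h : i ≤ j) (m : Fin k) :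
    i.castSucc.succAbove (j.succAbove m) = j.succ.succAbove (i.succAbove m) := by
  have h1 := h
  simp only [Fin.succAbove, Fin.lt_def, Fin.le_def] at *
  split_ifs <;> simp_all [Fin.ext_iff] <;> omega

/-- An alternating double sum over ordered pairs of distinct indices of a quantity that is
symmetric in the pair vanishes. -/
theorem sum_sum_neg_one_pow_eq_zero {k : ℕ} (F : Fin (k + 1) → Fin k → W)
    (hF : ∀ i j : Fin k, i ≤ j → F i.castSucc j = F j.succ i) :
    ∑ i : Fin (k + 1), ∑ j : Fin k, (-1 : ℝ) ^ (i : ℕ) • (-1 : ℝ) ^ (j : ℕ) • F i j = 0 := by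
  rw [Fin.sum_sum_eq_sum_triangle_add]
  refine Finset.sum_eq_zero fun i _ ↦ Finset.sum_eq_zero fun j hj ↦ ?_
  rw [hF i j (Finset.mem_Ici.1 hj), smul_smul, smul_smul, ← add_smul]
  simp only [Fin.val_castSucc, Fin.val_succ]
  rw [show (-1 : ℝ) ^ (i : ℕ) * (-1) ^ (j : ℕ) + (-1) ^ ((j : ℕ) + 1) * (-1) ^ (i : ℕ) = 0 by ring,
    zero_smul]

theorem neg_one_pow_smul_update_succAbove {k : ℕ} (α : T [⋀^Fin k]→ₗ[ℝ] W) (v : Fin (k + 1) → T)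
    {i j : Fin k} (h : i ≤ j) (z : T) :
    (-1 : ℝ) ^ ((j : ℕ) + 1) • α (Function.update (fun m ↦ v (j.succ.succAbove m)) i z) =
      -((-1 : ℝ) ^ (i : ℕ) • α (Function.update (fun m ↦ v (i.castSucc.succAbove m)) j z)) := by
  have hne : i.castSucc ≠ j.succ := (Fin.castSucc_lt_succ_iff.2 h).ne
  let v' := Function.update (Function.update v i.castSucc z) j.succ z
  have h1 : v' i.castSucc = v' j.succ := by simp [v', hne]
  have h2 := AlternatingMap.neg_one_pow_smul_map_removeNth_add_eq_zero_of_eq α h1 hne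
  have e1 : i.castSucc.removeNth v' =
      Function.update (fun m ↦ v (i.castSucc.succAbove m)) j z := by
    funext m
    rcases eq_or_ne m j with rfl | hm
    · simp [v', Fin.removeNth, castSucc_succAbove_of_le h]
    · have : i.castSucc.succAbove m ≠ j.succ := by
        rw [← castSucc_succAbove_of_le h]
        exact fun h ↦ hm (Fin.succAbove_right_injective h)
      simp [v', Fin.removeNth, hm, this]
  have e2 : j.succ.removeNth v' =
      Function.update (fun m ↦ v (j.succ.succAbove m)) i z := by
    funext m
    rcases eq_or_ne m i with rfl | hm
    · simp [v', Fin.removeNth, succ_succAbove_of_le h, hne]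
    · have : j.succ.succAbove m ≠ i.castSucc := by
        rw [← succ_succAbove_of_le h]
        exact fun h ↦ hm (Fin.succAbove_right_injective h)
      simp [v', Fin.removeNth, hm, this]
  rw [e1, e2] at h2
  have h3 : ∀ (n : ℕ) (w : W), ((-1 : ℤ) ^ n) • w = ((-1 : ℝ) ^ n) • w := by
    intro n w
    rcases Nat.even_or_odd n with h | h <;> simp [h.neg_one_pow]
  simp only [h3] at h2
  exact eq_neg_of_add_eq_zero_right h2

/-- The bracket terms of the exterior derivative, written through a torsion-free connection: `C i j`
stands for `∇_{X_i} X_j`, so that `C i j - C j i` is the bracket `[X_i, X_j]`. -/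
theorem sum_bracket_eq_sum_connection {k : ℕ} (α : T [⋀^Fin k]→ₗ[ℝ] W) (v : Fin (k + 1) → T)
    (C : Fin (k + 1) → Fin (k + 1) → T) :
    ∑ i : Fin (k + 1), (-1 : ℝ) ^ (i : ℕ) • ∑ m : Fin k with i < i.succAbove m,
        α (Function.update (fun m' ↦ v (i.succAbove m')) m
          (C i (i.succAbove m) - C (i.succAbove m) i)) =
      ∑ i : Fin (k + 1), (-1 : ℝ) ^ (i : ℕ) • ∑ m : Fin k,
        α (Function.update (fun m' ↦ v (i.succAbove m')) m (C i (i.succAbove m))) := by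
  simp only [Finset.sum_filter, Finset.smul_sum]
  rw [Fin.sum_sum_eq_sum_triangle_add, Fin.sum_sum_eq_sum_triangle_add]
  refine Finset.sum_congr rfl fun i _ ↦ Finset.sum_congr rfl fun j hj ↦ ?_
  have h := Finset.mem_Ici.1 hj
  have h1 : ¬ j.succ < i.castSucc := not_lt.2 (Fin.castSucc_lt_succ_iff.2 h).le
  rw [castSucc_succAbove_of_le h, succ_succAbove_of_le h, if_pos (Fin.castSucc_lt_succ_iff.2 h),
    if_neg h1, smul_zero, add_zero, Fin.val_succ, neg_one_pow_smul_update_succAbove α v h,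
    AlternatingMap.map_update_sub, smul_sub, sub_eq_add_neg, Fin.val_castSucc]

end PairSums

/-! ### The filtration by the number of arguments outside a subspace -/

section Filtration

variable {T W : Type*} [AddCommGroup T] [Module ℝ T] [AddCommGroup W] [Module ℝ W]

/-- The alternating form `α` vanishes as soon as fewer than `m` of its arguments lie outside the
subspace `B`. These forms are the `m`-th step of the filtration of the exterior algebra by powers of
the ideal that the annihilator of `B` generates. -/
def VanishesBelow (B : Submodule ℝ T) (m : ℕ) {k : ℕ} (α : T [⋀^Fin k]→ₗ[ℝ] W) : Prop :=
  ∀ v : Fin k → T, {i | v i ∉ B}.ncard < m → α v = 0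

theorem VanishesBelow.zero (B : Submodule ℝ T) {k : ℕ} (α : T [⋀^Fin k]→ₗ[ℝ] W) :
    VanishesBelow B 0 α := fun _ h ↦ absurd h (Nat.not_lt_zero _)

theorem VanishesBelow.eq_zero {A B : Submodule ℝ T} (hAB : IsCompl A B) {a b m : ℕ}
    (eA : Module.Basis (Fin a) ℝ A) (eB : Module.Basis (Fin b) ℝ B) (ham : a < m) {k : ℕ}
    {α : T [⋀^Fin k]→ₗ[ℝ] W} (hα : VanishesBelow B m α) : α = 0 := by
  let e : Module.Basis (Fin a ⊕ Fin b) ℝ T := (eA.prod eB).map (A.prodEquivOfIsCompl B hAB)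
  refine e.ext_alternating fun v hv ↦ ?_
  rw [AlternatingMap.zero_apply]
  refine hα _ (lt_of_le_of_lt ?_ ham)
  have h1 : ∀ i, e (v i) ∉ B → ∃ p, v i = Sum.inl p := by
    intro i hi
    rcases h : v i with p | p
    · exact ⟨p, rfl⟩
    · exact absurd (by simp [h, e]) hi
  have h2 : v '' {i | e (v i) ∉ B} ⊆ Set.range Sum.inl := by
    rintro _ ⟨i, hi, rfl⟩
    obtain ⟨p, hp⟩ := h1 i hi
    exact ⟨p, hp.symm⟩
  have h3 := Set.ncard_le_ncard h2
  rwa [Set.ncard_image_of_injective _ hv, ← Set.image_univ,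
    Set.ncard_image_of_injective _ Sum.inl_injective, Set.ncard_univ, Nat.card_fin] at h3

/-- Removing two arguments outside `B` lowers the number of arguments outside `B` by two. -/
theorem ncard_succAbove_succAbove {B : Submodule ℝ T} {k m : ℕ} {v : Fin (k + 2) → T}
    (hv : {i | v i ∉ B}.ncard < m + 2) {i : Fin (k + 2)} {j : Fin (k + 1)} (hi : v i ∉ B)
    (hj : v (i.succAbove j) ∉ B) :
    {p | v (i.succAbove (j.succAbove p)) ∉ B}.ncard < m := by
  obtain ⟨S, hS⟩ : ∃ S : Set (Fin (k + 2)), S = {q | v q ∉ B} := ⟨_, rfl⟩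
  obtain ⟨P, hP⟩ : ∃ P : Set (Fin (k + 2)), P = {i, i.succAbove j} := ⟨_, rfl⟩
  have h : ((fun p ↦ i.succAbove (j.succAbove p)) '' {p | v (i.succAbove (j.succAbove p)) ∉ B}) ⊆
      S \ P := by
    rintro _ ⟨p, hp, rfl⟩
    refine ⟨hS ▸ hp, ?_⟩
    simp only [hP, mem_insert_iff, mem_singleton_iff, not_or]
    exact ⟨Fin.succAbove_ne _ _, fun h ↦ Fin.succAbove_ne _ _ (Fin.succAbove_right_injective h)⟩
  have hinj : Function.Injective (fun p ↦ i.succAbove (j.succAbove p)) :=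
    Fin.succAbove_right_injective.comp Fin.succAbove_right_injective
  have h1 := Set.ncard_le_ncard h
  rw [Set.ncard_image_of_injective _ hinj] at h1
  have hne : i ≠ i.succAbove j := (Fin.succAbove_ne i j).symm
  have h2 : P ⊆ S := by
    rw [hP, hS]
    rintro q (rfl | rfl)
    · exact hi
    · exact hj
  have h3 := Set.ncard_sdiff_add_ncard_of_subset h2
  have h4 : P.ncard = 2 := hP ▸ Set.ncard_pair hne
  rw [← hS] at hv
  omega

end Filtration

/-! ### Coordinate vector fields, and forms evaluated on differentiable fields -/

section CoordinateFields

open VectorField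

variable {E : Type*} [NormedAddCommGroup E] [NormedSpace ℝ E] [FiniteDimensional ℝ E]
  {H : Type*} [TopologicalSpace H] {I : ModelWithCorners ℝ E H}
  {M : Type*} [TopologicalSpace M] [ChartedSpace H M] [IsManifold I ∞ M]

/-- The constant vector field `v` on the vector space `E`. -/
def constField (v : E) : Π y : E, TangentSpace 𝓘(ℝ, E) y := fun _ ↦ v

/-- The tangent vector `u` at `x` in the preferred chart at `x`. -/
def chartVector {x : M} (u : TangentSpace I x) : E := mfderiv I 𝓘(ℝ, E) (extChartAt I x) x u

/-- The extension of the tangent vector `u` at `x` to the vector field that is constant in the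
preferred chart at `x`. These extensions commute with each other on the domain of the chart. -/
def coordExt {x : M} (u : TangentSpace I x) : Π y : M, TangentSpace I y :=
  mpullback I 𝓘(ℝ, E) (extChartAt I x) (constField (chartVector u))

theorem coordExt_self {x : M} (u : TangentSpace I x) : coordExt u x = u :=
  (isInvertible_mfderiv_extChartAt (I := I) (mem_extChartAt_source (I := I) x)).inverse_apply_eq.2
    rfl

theorem coordExt_add {x : M} (u v : TangentSpace I x) (y : M) :
    coordExt (u + v) y = coordExt u y + coordExt v y := by
  have h : constField (chartVector (u + v)) =
      constField (chartVector u) + constField (chartVector v) :=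
    funext fun _ ↦ map_add (mfderiv I 𝓘(ℝ, E) (extChartAt I x) x) u v
  rw [coordExt, h, mpullback_add]
  rfl

theorem coordExt_smul {x : M} (c : ℝ) (u : TangentSpace I x) (y : M) :
    coordExt (c • u) y = c • coordExt u y := by
  have h : constField (chartVector (c • u)) = c • constField (chartVector u) :=
    funext fun _ ↦ map_smul (mfderiv I 𝓘(ℝ, E) (extChartAt I x) x) c u
  rw [coordExt, h, mpullback_const_smul]
  rfl

theorem contMDiffAt_constField (v : E) (y : E) :
    ContMDiffAt 𝓘(ℝ, E) (𝓘(ℝ, E).prod 𝓘(ℝ, E)) ∞ (T% (constField v)) y :=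
  contMDiffAt_vectorSpace_iff_contDiffAt.2 contDiffAt_const

theorem smoothField_coordExt {x : M} (u : TangentSpace I x) :
    SmoothField (chartAt H x).source (coordExt u) := by
  have : CompleteSpace E := FiniteDimensional.complete ℝ E
  intro y hy
  refine ContMDiffAt.contMDiffWithinAt ?_
  exact ContMDiffAt.mpullback_vectorField_preimage (n := ∞)
    (contMDiffAt_constField _ _) (contMDiffAt_extChartAt' hy)
    (isInvertible_mfderiv_extChartAt (by rwa [extChartAt_source])) (by simp)

theorem mlieBracket_constField (u v : E) :
    mlieBracket 𝓘(ℝ, E) (constField u) (constField v) = 0 := by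
  rw [← mlieBracketWithin_univ, mlieBracketWithin_eq_lieBracketWithin]
  funext y
  change fderivWithin ℝ (fun _ : E ↦ v) univ y u - fderivWithin ℝ (fun _ : E ↦ u) univ y v = 0
  simp

theorem mlieBracket_coordExt {x : M} (u v : TangentSpace I x) {y : M}
    (hy : y ∈ (chartAt H x).source) : mlieBracket I (coordExt u) (coordExt v) y = 0 := by
  have : CompleteSpace E := FiniteDimensional.complete ℝ E
  have : IsManifold I (minSmoothness ℝ 2) M := by
    rw [minSmoothness_of_isRCLikeNormedField]
    infer_instance
  rw [coordExt, coordExt, ← mpullback_mlieBracket (n := ∞)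
    ((contMDiffAt_constField _ _).mdifferentiableAt (by simp))
    ((contMDiffAt_constField _ _).mdifferentiableAt (by simp))
    (contMDiffAt_extChartAt' hy) (by simpa using ENat.LEInfty.out), mlieBracket_constField,
    mpullback_zero]
  rfl

end CoordinateFields

section Differentiability

variable {E : Type*} [NormedAddCommGroup E] [NormedSpace ℝ E] [FiniteDimensional ℝ E]
  {H : Type*} [TopologicalSpace H] {I : ModelWithCorners ℝ E H}
  {M : Type*} [TopologicalSpace M] [ChartedSpace H M] [IsManifold I ∞ M]
  {F : Type*} [NormedAddCommGroup F] [NormedSpace ℝ F]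
  {V : M → Type*} [TopologicalSpace (TotalSpace F V)]
  [∀ x, AddCommGroup (V x)] [∀ x, Module ℝ (V x)] [∀ x, TopologicalSpace (V x)]
  [FiberBundle F V] [VectorBundle ℝ F V]

theorem SmoothField.mdifferentiableAt {U : Set M} (hU : IsOpen U) {X : Π x : M, TangentSpace I x}
    (hX : SmoothField U X) {x : M} (hx : x ∈ U) : MDiffAt (T% X) x :=
  ((hX x hx).contMDiffAt (hU.mem_nhds hx)).mdifferentiableAt (by simp)

theorem mdifferentiableAt_coordExt {x : M} (u : TangentSpace I x) : MDiffAt (T% (coordExt u)) x :=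
  (smoothField_coordExt u).mdifferentiableAt (chartAt H x).open_source (mem_chart_source H x)

/-- Smooth forms take vector fields that are differentiable at a point to sections that are
differentiable at this point. -/
theorem mdifferentiableAt_vForm {k : ℕ} (α : VForm I F V k) {x : M}
    {X : Fin k → Π y : M, TangentSpace I y} (hX : ∀ i, MDiffAt (T% (X i)) x) :
    MDiffAt (T% (fun y ↦ α.1 y fun i ↦ X i y)) x := by
  classical
  let e := trivializationAt E (TangentSpace I : M → Type _) x
  have hxe : x ∈ e.baseSet := FiberBundle.mem_baseSet_trivializationAt E (TangentSpace I) x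
  let b := Module.finBasis ℝ E
  let s := e.localFrame b
  let c := e.localFrameCoeff I b
  have hs : ∀ r : Fin k → Fin (Module.finrank ℝ E),
      MDiffAt (T% (fun y ↦ α.1 y fun i ↦ s (r i) y)) x := fun r ↦
    ((α.2 e.baseSet e.open_baseSet (fun i ↦ s (r i)) fun i ↦
      e.contMDiffOn_localFrame_baseSet ∞ b (r i)).contMDiffAt
        (e.open_baseSet.mem_nhds hxe)).mdifferentiableAt (by simp)
  have hc : ∀ i j, MDiffAt (fun y ↦ c j y (X i y)) x := fun i j ↦
    mdifferentiableAt_localFrameCoeff b hxe (hX i) j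
  have key : MDiffAt (T% (fun y ↦ ∑ r : Fin k → Fin (Module.finrank ℝ E),
      (∏ i, c (r i) y (X i y)) • α.1 y fun i ↦ s (r i) y)) x := by
    refine .sum_section fun r _ ↦ ?_
    refine MDifferentiableAt.smul_section ?_ (hs r)
    have h : (fun y ↦ ∏ i, c (r i) y (X i y)) = ∏ i, fun y ↦ c (r i) y (X i y) := by
      funext y
      rw [Finset.prod_apply]
    rw [h]
    exact MDifferentiableAt.prod fun i _ ↦ hc i (r i)
  refine key.congr_of_eventuallyEq ?_
  filter_upwards [e.open_baseSet.mem_nhds hxe] with y hy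
  have h : (fun i ↦ X i y) = fun i ↦ ∑ j, c j y (X i y) • s j y := by
    funext i
    exact Trivialization.eq_sum_localFrameCoeff_smul hy
  have h2 := (α.1 y).toMultilinearMap.map_sum (fun i j ↦ c j y (X i y) • s j y)
  have h3 : (α.1 y fun i ↦ X i y) = ∑ r : Fin k → Fin (Module.finrank ℝ E),
      (∏ i, c (r i) y (X i y)) • α.1 y fun i ↦ s (r i) y := by
    rw [h]
    refine h2.trans (Finset.sum_congr rfl fun r _ ↦ ?_)
    exact (α.1 y).toMultilinearMap.map_smul_univ _ _
  exact congrArg (TotalSpace.mk' F y) h3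

end Differentiability

/-! ### Existence and uniqueness of the exterior covariant derivative -/

section Existence

open VectorField

variable {E : Type*} [NormedAddCommGroup E] [NormedSpace ℝ E] [FiniteDimensional ℝ E]
  {H : Type*} [TopologicalSpace H] {I : ModelWithCorners ℝ E H}
  {M : Type*} [TopologicalSpace M] [ChartedSpace H M] [IsManifold I ∞ M]
  {F : Type*} [NormedAddCommGroup F] [NormedSpace ℝ F]
  {V : M → Type*} [TopologicalSpace (TotalSpace F V)]
  [∀ x, AddCommGroup (V x)] [∀ x, Module ℝ (V x)] [∀ x, TopologicalSpace (V x)]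
  [∀ x, IsTopologicalAddGroup (V x)] [∀ x, ContinuousSMul ℝ (V x)]
  [FiberBundle F V] [VectorBundle ℝ F V]

/-- An operation on tuples of vector fields that is tensorial in each of them depends only on the
values of the fields at the point. -/
theorem eq_of_tensorialAt {A : Type*} [AddCommGroup A] [Module ℝ A] {k : ℕ} {x : M}
    (Φ : (Fin k → Π y : M, TangentSpace I y) → A)
    (hΦ : ∀ X : Fin k → Π y : M, TangentSpace I y, (∀ i, MDiffAt (T% (X i)) x) →
      ∀ i, TensorialAt I E (fun Z ↦ Φ (Function.update X i Z)) x)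
    {X Y : Fin k → Π y : M, TangentSpace I y} (hX : ∀ i, MDiffAt (T% (X i)) x)
    (hY : ∀ i, MDiffAt (T% (Y i)) x) (hXY : ∀ i, X i x = Y i x) : Φ X = Φ Y := by
  classical
  suffices h : ∀ s : Finset (Fin k), Φ (s.piecewise Y X) = Φ X by
    simpa using (h Finset.univ).symm
  intro s
  induction s using Finset.induction_on with
  | empty => simp
  | insert i s hi ih =>
    have hd : ∀ j, MDiffAt (T% (s.piecewise Y X j)) x := by
      intro j
      by_cases hj : j ∈ s
      · simpa [hj] using hY j
      · simpa [hj] using hX j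
    have h1 := (hΦ _ hd i).pointwise (hY i) (hX i) (hXY i).symm
    rw [Finset.piecewise_insert, ← ih]
    refine h1.trans (congrArg Φ ?_)
    rw [← Finset.piecewise_eq_of_notMem s Y X hi, Function.update_eq_self]

/-- The covariant derivative `(∇_v α)(X_1, …, X_k)` of a form at `x`, computed with the connection
`nab` on the bundle of values and the connection `cov` on the tangent bundle. -/
def covDeriv (nab : CovariantDerivative I F V)
    (cov : CovariantDerivative I E (TangentSpace I : M → Type _)) {k : ℕ} (α : VForm I F V k)
    (X : Fin k → Π y : M, TangentSpace I y) (x : M) (v : TangentSpace I x) : V x :=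
  nab (fun y ↦ α.1 y fun i ↦ X i y) x v -
    ∑ i, α.1 x (Function.update (fun j ↦ X j x) i (cov (X i) x v))

theorem update_field_apply {k : ℕ} (X : Fin k → Π y : M, TangentSpace I y) (i : Fin k)
    (Z : Π y : M, TangentSpace I y) (y : M) :
    (fun j ↦ Function.update X i Z j y) = Function.update (fun j ↦ X j y) i (Z y) := by
  funext j
  rcases eq_or_ne j i with rfl | h <;> simp [*]

theorem covDeriv_update (nab : CovariantDerivative I F V)
    (cov : CovariantDerivative I E (TangentSpace I : M → Type _)) {k : ℕ} (α : VForm I F V k)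
    (X : Fin k → Π y : M, TangentSpace I y) (x : M) (v : TangentSpace I x) (i : Fin k)
    (Z : Π y : M, TangentSpace I y) :
    covDeriv nab cov α (Function.update X i Z) x v =
      nab (fun y ↦ α.1 y (Function.update (fun j ↦ X j y) i (Z y))) x v -
        (α.1 x (Function.update (fun j ↦ X j x) i (cov Z x v)) +
          ∑ j ∈ Finset.univ.erase i, α.1 x (Function.update
            (Function.update (fun j ↦ X j x) j (cov (X j) x v)) i (Z x))) := by
  rw [covDeriv]
  simp only [update_field_apply]
  rw [← Finset.add_sum_erase _ _ (Finset.mem_univ i)]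
  congr 2
  · simp
  · refine Finset.sum_congr rfl fun j hj ↦ ?_
    have h := Finset.ne_of_mem_erase hj
    rw [Function.update_of_ne h, Function.update_comm h]

theorem mdifferentiableAt_update {k : ℕ} (α : VForm I F V k) {x : M}
    {X : Fin k → Π y : M, TangentSpace I y} (hX : ∀ i, MDiffAt (T% (X i)) x) (i : Fin k)
    {Z : Π y : M, TangentSpace I y} (hZ : MDiffAt (T% Z) x) :
    MDiffAt (T% (fun y ↦ α.1 y (Function.update (fun j ↦ X j y) i (Z y)))) x := by
  have h := mdifferentiableAt_vForm α (X := Function.update X i Z) (x := x) (fun j ↦ by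
    rcases eq_or_ne j i with rfl | h
    · simpa using hZ
    · simpa [h] using hX j)
  simpa only [update_field_apply] using h

theorem tensorialAt_covDeriv (nab : CovariantDerivative I F V)
    (cov : CovariantDerivative I E (TangentSpace I : M → Type _)) {k : ℕ} (α : VForm I F V k)
    {x : M} (v : TangentSpace I x) (X : Fin k → Π y : M, TangentSpace I y)
    (hX : ∀ i, MDiffAt (T% (X i)) x) (i : Fin k) :
    TensorialAt I E (fun Z ↦ covDeriv nab cov α (Function.update X i Z) x v) x where
  smul {f Z} hf hZ := by
    have h1 : (fun y ↦ α.1 y (Function.update (fun j ↦ X j y) i ((f • Z) y))) =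
        f • fun y ↦ α.1 y (Function.update (fun j ↦ X j y) i (Z y)) :=
      funext fun y ↦ (α.1 y).map_update_smul _ _ _ _
    simp only [covDeriv_update]
    rw [h1, nab.isCovariantDerivativeOnUniv.leibniz (mdifferentiableAt_update α hX i hZ) hf,
      cov.isCovariantDerivativeOnUniv.leibniz hZ hf]
    simp only [add_apply, smul_apply,
      ContinuousLinearMap.smulRight_apply, Pi.smul_apply', AlternatingMap.map_update_add,
      AlternatingMap.map_update_smul, ← Finset.smul_sum]
    module
  add {Z Z'} hZ hZ' := by
    have h1 : (fun y ↦ α.1 y (Function.update (fun j ↦ X j y) i ((Z + Z') y))) =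
        (fun y ↦ α.1 y (Function.update (fun j ↦ X j y) i (Z y))) +
          fun y ↦ α.1 y (Function.update (fun j ↦ X j y) i (Z' y)) :=
      funext fun y ↦ (α.1 y).map_update_add _ _ _ _
    simp only [covDeriv_update]
    rw [h1, nab.isCovariantDerivativeOnUniv.add (mdifferentiableAt_update α hX i hZ)
      (mdifferentiableAt_update α hX i hZ'), cov.isCovariantDerivativeOnUniv.add hZ hZ']
    simp only [add_apply, Pi.add_apply, AlternatingMap.map_update_add,
      Finset.sum_add_distrib]
    abel

/-- The right-hand side of the formula that defines the exterior covariant derivative. -/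
def exteriorFormula (nab : (Π x : M, V x) → (Π x : M, TangentSpace I x →L[ℝ] V x)) {k : ℕ}
    (α : VForm I F V k) (X : Fin (k + 1) → Π x : M, TangentSpace I x) (x : M) : V x :=
  ∑ i : Fin (k + 1), (-1 : ℝ) ^ (i : ℕ) •
    (nab (fun y ↦ α.1 y fun m ↦ X (i.succAbove m) y) x (X i x) -
      ∑ m : Fin k with i < i.succAbove m,
        α.1 x (Function.update (fun m' ↦ X (i.succAbove m') x) m
          (mlieBracket I (X i) (X (i.succAbove m)) x)))

theorem exteriorFormula_eq_sum_covDeriv [CompleteSpace E] (nab : CovariantDerivative I F V)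
    {cov : CovariantDerivative I E (TangentSpace I : M → Type _)} (hcov : cov.torsion = 0)
    {k : ℕ} (α : VForm I F V k) {X : Fin (k + 1) → Π x : M, TangentSpace I x} {x : M}
    (hX : ∀ i, MDiffAt (T% (X i)) x) :
    exteriorFormula nab α X x = ∑ i : Fin (k + 1), (-1 : ℝ) ^ (i : ℕ) •
      covDeriv nab cov α (fun m ↦ X (i.succAbove m)) x (X i x) := by
  have h1 : ∀ i j, mlieBracket I (X i) (X j) x = cov (X j) x (X i x) - cov (X i) x (X j x) :=
    fun i j ↦ (cov.torsion_eq_zero_iff.1 hcov (hX i) (hX j)).symm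
  have h2 := sum_bracket_eq_sum_connection (α.1 x) (fun i ↦ X i x)
    (fun i j ↦ cov (X j) x (X i x))
  simp only [exteriorFormula, covDeriv, smul_sub, Finset.sum_sub_distrib, h1]
  rw [h2]

/-- The derivative `∇_v (α(w_1, …, w_k))` of a form at `x`, where the vectors `w_i` are extended to
coordinate fields. It depends on the chart, but its antisymmetrisation does not. -/
def coordDeriv (nab : CovariantDerivative I F V) {k : ℕ} (α : VForm I F V k) (x : M) :
    TangentSpace I x →ₗ[ℝ] (TangentSpace I x) [⋀^Fin k]→ₗ[ℝ] V x where
  toFun v :=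
    { toFun := fun w ↦ nab (fun y ↦ α.1 y fun i ↦ coordExt (w i) y) x v
      map_update_add' := by
        intro _ w i u u'
        have h0 : ∀ z, (fun y ↦ α.1 y fun j ↦ coordExt (Function.update w i z j) y) =
            fun y ↦ α.1 y (Function.update (fun j ↦ coordExt (w j) y) i (coordExt z y)) := by
          intro z
          funext y
          congr 1
          funext j
          rcases eq_or_ne j i with rfl | h <;> simp [*]
        have h1 : (fun y ↦ α.1 y (Function.update (fun j ↦ coordExt (w j) y) i
            (coordExt (u + u') y))) =
            (fun y ↦ α.1 y (Function.update (fun j ↦ coordExt (w j) y) i (coordExt u y))) +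
              fun y ↦ α.1 y (Function.update (fun j ↦ coordExt (w j) y) i (coordExt u' y)) := by
          funext y
          rw [coordExt_add, AlternatingMap.map_update_add]
          rfl
        have h2 : ∀ z, MDiffAt (T% (fun y ↦ α.1 y (Function.update (fun j ↦ coordExt (w j) y) i
            (coordExt z y)))) x := fun z ↦ by
          convert mdifferentiableAt_update α (X := fun j ↦ coordExt (w j))
            (fun j ↦ mdifferentiableAt_coordExt (w j)) i (mdifferentiableAt_coordExt z)
        simp only [h0]
        rw [h1, nab.isCovariantDerivativeOnUniv.add (h2 u) (h2 u')]
        rfl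
      map_update_smul' := by
        intro _ w i c u
        have h0 : ∀ z, (fun y ↦ α.1 y fun j ↦ coordExt (Function.update w i z j) y) =
            fun y ↦ α.1 y (Function.update (fun j ↦ coordExt (w j) y) i (coordExt z y)) := by
          intro z
          funext y
          congr 1
          funext j
          rcases eq_or_ne j i with rfl | h <;> simp [*]
        have h1 : (fun y ↦ α.1 y (Function.update (fun j ↦ coordExt (w j) y) i
            (coordExt (c • u) y))) =
            c • (fun y ↦ α.1 y (Function.update (fun j ↦ coordExt (w j) y) i (coordExt u y))) := by
          funext y
          rw [coordExt_smul, AlternatingMap.map_update_smul]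
          rfl
        have h2 : MDiffAt (T% (fun y ↦ α.1 y (Function.update (fun j ↦ coordExt (w j) y) i
            (coordExt u y)))) x := by
          convert mdifferentiableAt_update α (X := fun j ↦ coordExt (w j))
            (fun j ↦ mdifferentiableAt_coordExt (w j)) i (mdifferentiableAt_coordExt u)
        simp only [h0]
        rw [h1, nab.isCovariantDerivativeOnUniv.smul_const c h2]
        rfl
      map_eq_zero_of_eq' := by
        intro w i j hij hne
        have h : (fun y ↦ α.1 y fun i ↦ coordExt (w i) y) = 0 :=
          funext fun y ↦ (α.1 y).map_eq_zero_of_eq _ (by rw [hij]) hne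
        change nab (fun y ↦ α.1 y fun i ↦ coordExt (w i) y) x v = 0
        rw [h, nab.zero]
        rfl }
  map_add' v v' := by
    ext w
    exact map_add (nab (fun y ↦ α.1 y fun i ↦ coordExt (w i) y) x) v v'
  map_smul' c v := by
    ext w
    exact map_smul (nab (fun y ↦ α.1 y fun i ↦ coordExt (w i) y) x) c v

theorem coordDeriv_apply (nab : CovariantDerivative I F V) {k : ℕ} (α : VForm I F V k) (x : M)
    (v : TangentSpace I x) (w : Fin k → TangentSpace I x) :
    coordDeriv nab α x v w = nab (fun y ↦ α.1 y fun i ↦ coordExt (w i) y) x v := rfl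

theorem exteriorFormula_coordExt (nab : CovariantDerivative I F V) {k : ℕ} (α : VForm I F V k)
    {x : M} (w : Fin (k + 1) → TangentSpace I x) {y : M} (hy : y ∈ (chartAt H x).source) :
    exteriorFormula nab α (fun i ↦ coordExt (w i)) y = ∑ i : Fin (k + 1), (-1 : ℝ) ^ (i : ℕ) •
      nab (fun z ↦ α.1 z fun m ↦ coordExt (w (i.succAbove m)) z) y (coordExt (w i) y) := by
  refine Finset.sum_congr rfl fun i _ ↦ ?_
  rw [Finset.sum_eq_zero, sub_zero]
  intro m _
  rw [mlieBracket_coordExt _ _ hy]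
  exact (α.1 y).map_update_zero _ _

/-- The formula for the exterior derivative is tensorial: its value at `x` is that of the
antisymmetrised coordinate derivative. -/
theorem alternatizeUncurryFin_coordDeriv [CompleteSpace E] (nab : CovariantDerivative I F V)
    {cov : CovariantDerivative I E (TangentSpace I : M → Type _)} (hcov : cov.torsion = 0)
    {k : ℕ} (α : VForm I F V k) {X : Fin (k + 1) → Π x : M, TangentSpace I x} {x : M}
    (hX : ∀ i, MDiffAt (T% (X i)) x) :
    AlternatingMap.alternatizeUncurryFin (coordDeriv nab α x) (fun i ↦ X i x) =
      exteriorFormula nab α X x := by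
  have h1 : AlternatingMap.alternatizeUncurryFin (coordDeriv nab α x) (fun i ↦ X i x) =
      exteriorFormula nab α (fun i ↦ coordExt (X i x)) x := by
    rw [exteriorFormula_coordExt nab α _ (mem_chart_source H x),
      AlternatingMap.alternatizeUncurryFin_apply]
    refine Finset.sum_congr rfl fun i _ ↦ ?_
    rw [coordExt_self]
    rcases Nat.even_or_odd (i : ℕ) with h | h <;> simp [h.neg_one_pow, coordDeriv_apply] <;> rfl
  rw [h1, exteriorFormula_eq_sum_covDeriv nab hcov α fun i ↦ mdifferentiableAt_coordExt _,
    exteriorFormula_eq_sum_covDeriv nab hcov α hX]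
  refine Finset.sum_congr rfl fun i _ ↦ ?_
  rw [coordExt_self, eq_of_tensorialAt (fun X ↦ covDeriv nab cov α X x _)
    (fun X hX i ↦ tensorialAt_covDeriv nab cov α _ X hX i)
    (fun m ↦ mdifferentiableAt_coordExt _) (fun m ↦ hX (i.succAbove m))
    fun m ↦ coordExt_self _]

/-- The connection `nab` takes smooth sections and smooth vector fields to smooth sections. -/
def IsSmoothConnection (nab : CovariantDerivative I F V) : Prop :=
  ∀ (U : Set M), IsOpen U → ∀ (s : Π x : M, V x) (X : Π x : M, TangentSpace I x),
    ContMDiffOn I (I.prod 𝓘(ℝ, F)) ∞ (fun x ↦ TotalSpace.mk' F x (s x)) U → SmoothField U X →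
      ContMDiffOn I (I.prod 𝓘(ℝ, F)) ∞ (fun x ↦ TotalSpace.mk' F x (nab s x (X x))) U

theorem SmoothField.mlieBracket {U : Set M} (hU : IsOpen U) {X Y : Π x : M, TangentSpace I x}
    (hX : SmoothField U X) (hY : SmoothField U Y) : SmoothField U (mlieBracket I X Y) := by
  have : CompleteSpace E := FiniteDimensional.complete ℝ E
  intro x hx
  refine ContMDiffAt.contMDiffWithinAt ?_
  have : IsManifold I (minSmoothness ℝ 2) M := by
    rw [minSmoothness_of_isRCLikeNormedField]
    infer_instance
  have : IsManifold I (((⊤ : ℕ∞) : ℕ∞ω) + 1) M := inferInstanceAs (IsManifold I ∞ M)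
  exact ContMDiffAt.mlieBracket_vectorField (m := ⊤) (n := ⊤)
    ((hX x hx).contMDiffAt (hU.mem_nhds hx)) ((hY x hx).contMDiffAt (hU.mem_nhds hx)) (by simp)

theorem contMDiffOn_exteriorFormula {nab : CovariantDerivative I F V}
    (hnab : IsSmoothConnection nab) {k : ℕ} (α : VForm I F V k) {U : Set M} (hU : IsOpen U)
    {X : Fin (k + 1) → Π x : M, TangentSpace I x} (hX : ∀ i, SmoothField U (X i)) :
    ContMDiffOn I (I.prod 𝓘(ℝ, F)) ∞
      (fun x ↦ TotalSpace.mk' F x (exteriorFormula nab α X x)) U := by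
  refine ContMDiffOn.sum_section fun i _ ↦ ContMDiffOn.const_smul_section
    (ContMDiffOn.sub_section ?_ (ContMDiffOn.sum_section fun m _ ↦ ?_))
  · exact hnab U hU _ _ (α.2 U hU _ fun m ↦ hX _) (hX i)
  · have h := α.2 U hU (Function.update (fun m' ↦ X (i.succAbove m')) m
      (mlieBracket I (X i) (X (i.succAbove m)))) (fun j ↦ by
        rcases eq_or_ne j m with rfl | h
        · simpa using (hX i).mlieBracket hU (hX _)
        · simpa [h] using hX _)
    simpa only [update_field_apply] using h

/-- The exterior covariant derivative of a smooth connection. The torsion-free connection `cov` on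
the tangent bundle serves to show that it is well defined. -/
def exteriorDeriv [CompleteSpace E] {nab : CovariantDerivative I F V}
    (hnab : IsSmoothConnection nab)
    {cov : CovariantDerivative I E (TangentSpace I : M → Type _)} (hcov : cov.torsion = 0)
    (k : ℕ) : VForm I F V k →ₗ[ℝ] VForm I F V (k + 1) where
  toFun α := ⟨fun x ↦ AlternatingMap.alternatizeUncurryFin (coordDeriv nab α x),
    fun U hU X hX ↦ (contMDiffOn_exteriorFormula hnab α hU hX).congr fun x hx ↦ by
      rw [alternatizeUncurryFin_coordDeriv nab hcov α fun i ↦ (hX i).mdifferentiableAt hU hx]⟩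
  map_add' α β := by
    refine Subtype.ext (funext fun x ↦ ?_)
    have h : coordDeriv nab (α + β) x = coordDeriv nab α x + coordDeriv nab β x := by
      ext v w
      have h1 := nab.isCovariantDerivativeOnUniv.add (x := x)
        (mdifferentiableAt_vForm α fun i ↦ mdifferentiableAt_coordExt (w i))
        (mdifferentiableAt_vForm β fun i ↦ mdifferentiableAt_coordExt (w i))
      exact congrArg (fun L : TangentSpace I x →L[ℝ] V x ↦ L v) h1
    exact (congrArg _ h).trans (AlternatingMap.alternatizeUncurryFin_add _ _)
  map_smul' c α := by
    refine Subtype.ext (funext fun x ↦ ?_)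
    have h : coordDeriv nab (c • α) x = c • coordDeriv nab α x := by
      ext v w
      have h1 := nab.isCovariantDerivativeOnUniv.smul_const (x := x) c
        (mdifferentiableAt_vForm α fun i ↦ mdifferentiableAt_coordExt (w i))
      exact congrArg (fun L : TangentSpace I x →L[ℝ] V x ↦ L v) h1
    exact (congrArg _ h).trans (AlternatingMap.alternatizeUncurryFin_smul _ _)

theorem isExteriorCovariantDerivative_exteriorDeriv [CompleteSpace E]
    {nab : CovariantDerivative I F V} (hnab : IsSmoothConnection nab)
    {cov : CovariantDerivative I E (TangentSpace I : M → Type _)} (hcov : cov.torsion = 0) :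
    IsExteriorCovariantDerivative nab (exteriorDeriv hnab hcov) :=
  fun _ α _ hU _ hX _ hx ↦
    alternatizeUncurryFin_coordDeriv nab hcov α fun i ↦ (hX i).mdifferentiableAt hU hx

/-- An exterior covariant derivative is at each point the antisymmetrised coordinate derivative; in
particular it is unique. -/
theorem IsExteriorCovariantDerivative.eq_alternatizeUncurryFin {nab : CovariantDerivative I F V}
    {D : ∀ k, VForm I F V k →ₗ[ℝ] VForm I F V (k + 1)} (hD : IsExteriorCovariantDerivative nab D)
    {k : ℕ} (α : VForm I F V k) (x : M) :
    (D k α).1 x = AlternatingMap.alternatizeUncurryFin (coordDeriv nab α x) := by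
  ext w
  have h := hD k α (chartAt H x).source (chartAt H x).open_source (fun i ↦ coordExt (w i))
    (fun i ↦ smoothField_coordExt _) x (mem_chart_source H x)
  have h2 := exteriorFormula_coordExt nab α w (mem_chart_source H x)
  rw [exteriorFormula] at h2
  rw [h2] at h
  simp only [coordExt_self] at h
  rw [h, AlternatingMap.alternatizeUncurryFin_apply]
  refine Finset.sum_congr rfl fun i _ ↦ ?_
  rcases Nat.even_or_odd (i : ℕ) with h | h <;> simp [h.neg_one_pow, coordDeriv_apply] <;> rfl

theorem existsUnique_isExteriorCovariantDerivative [CompleteSpace E]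
    {nab : CovariantDerivative I F V} (hnab : IsSmoothConnection nab)
    {cov : CovariantDerivative I E (TangentSpace I : M → Type _)} (hcov : cov.torsion = 0) :
    ∃! D : ∀ k, VForm I F V k →ₗ[ℝ] VForm I F V (k + 1),
      IsExteriorCovariantDerivative nab D := by
  refine ⟨exteriorDeriv hnab hcov, isExteriorCovariantDerivative_exteriorDeriv hnab hcov,
    fun D hD ↦ funext fun k ↦ LinearMap.ext fun α ↦ Subtype.ext (funext fun x ↦ ?_)⟩
  exact hD.eq_alternatizeUncurryFin α x

end Existence

/-! ### The derivative of functions as a connection on the trivial line bundle -/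

section TrivialConnection

open VectorField

variable {E : Type*} [NormedAddCommGroup E] [NormedSpace ℝ E] [FiniteDimensional ℝ E]
  {H : Type*} [TopologicalSpace H] {I : ModelWithCorners ℝ E H}
  {M : Type*} [TopologicalSpace M] [ChartedSpace H M] [IsManifold I ∞ M]

theorem contMDiffOn_trivial_iff {f : M → ℝ} {U : Set M} :
    ContMDiffOn I (I.prod 𝓘(ℝ, ℝ)) ∞
      (fun x ↦ (TotalSpace.mk' ℝ x (f x) : TotalSpace ℝ (Bundle.Trivial M ℝ))) U ↔
      ContMDiffOn I 𝓘(ℝ, ℝ) ∞ f U :=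
  forall₂_congr fun _ _ ↦ contMDiffWithinAt_section

theorem mdifferentiableAt_trivial_iff {f : M → ℝ} {x : M} :
    MDifferentiableAt I (I.prod 𝓘(ℝ, ℝ))
      (fun x ↦ (TotalSpace.mk' ℝ x (f x) : TotalSpace ℝ (Bundle.Trivial M ℝ))) x ↔
      MDifferentiableAt I 𝓘(ℝ, ℝ) f x :=
  mdifferentiableAt_section I (F := ℝ) (E := Bundle.Trivial M ℝ) _

/-- The derivative of the real function `f` along the tangent vector `v`, as a real number. -/
def dirDeriv (f : M → ℝ) {x : M} (v : TangentSpace I x) : ℝ := mfderiv I 𝓘(ℝ, ℝ) f x v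

theorem contMDiffOn_dirDeriv {f : M → ℝ} {U : Set M} (hU : IsOpen U)
    {X : Π x : M, TangentSpace I x} (hf : ContMDiffOn I 𝓘(ℝ, ℝ) ∞ f U) (hX : SmoothField U X) :
    ContMDiffOn I 𝓘(ℝ, ℝ) ∞ (fun x ↦ dirDeriv f (X x)) U := by
  have h1 : ContMDiffOn I.tangent 𝓘(ℝ, ℝ).tangent ∞ (tangentMapWithin I 𝓘(ℝ, ℝ) f U)
      (TotalSpace.proj ⁻¹' U) :=
    hf.contMDiffOn_tangentMapWithin (by simp) hU.uniqueMDiffOn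
  have h2 := (contMDiff_snd_tangentBundle_modelSpace ℝ 𝓘(ℝ, ℝ) (n := ∞)).comp_contMDiffOn
    (h1.comp hX fun x hx ↦ hx)
  refine h2.congr fun x hx ↦ ?_
  change mfderiv I 𝓘(ℝ, ℝ) f x (X x) = mfderivWithin I 𝓘(ℝ, ℝ) f U x (X x)
  rw [mfderivWithin_of_isOpen hU hx]

variable (I M) in
/-- The derivative of real functions, as a connection on the trivial line bundle. -/
def trivialConnection : CovariantDerivative I ℝ (Bundle.Trivial M ℝ) where
  toFun (f : M → ℝ) x := mfderiv I 𝓘(ℝ, ℝ) f x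
  isCovariantDerivativeOnUniv :=
    { add := by
        intro f f' x hf hf' _
        exact mfderiv_add (mdifferentiableAt_trivial_iff.1 hf) (mdifferentiableAt_trivial_iff.1 hf')
      leibniz := by
        intro f h x hf hh _
        exact mvfderiv_smul hh (mdifferentiableAt_trivial_iff.1 hf) }

theorem isSmoothConnection_trivialConnection : IsSmoothConnection (trivialConnection I M) :=
  fun _ hU _ _ hf hX ↦ contMDiffOn_trivial_iff.2
    (contMDiffOn_dirDeriv hU (contMDiffOn_trivial_iff.1 hf) hX)

end TrivialConnection

/-! ### Smoothness of the Levi-Civita connection -/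

section LeviCivita

open VectorField

variable {E : Type*} [NormedAddCommGroup E] [NormedSpace ℝ E] [FiniteDimensional ℝ E]
  {H : Type*} [TopologicalSpace H] {I : ModelWithCorners ℝ E H}
  {M : Type*} [TopologicalSpace M] [ChartedSpace H M] [IsManifold I ∞ M]
  {g : ContMDiffRiemannianMetric I ∞ E (TangentSpace I : M → Type _)}
  {cov : CovariantDerivative I E (TangentSpace I : M → Type _)}

theorem contMDiffOn_inner (g : ContMDiffRiemannianMetric I ∞ E (TangentSpace I : M → Type _))
    {U : Set M} {X Y : Π x : M, TangentSpace I x} (hX : SmoothField U X) (hY : SmoothField U Y) :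
    ContMDiffOn I 𝓘(ℝ, ℝ) ∞ (fun x ↦ g.inner x (X x) (Y x)) U :=
  contMDiffOn_trivial_iff.1
    (ContMDiffOn.clm_bundle_apply₂ (E₃ := Bundle.Trivial M ℝ) g.contMDiff.contMDiffOn hX hY)

theorem contMDiffOn_det {ι : Type*} [Fintype ι] [DecidableEq ι] {G : M → Matrix ι ι ℝ} {U : Set M}
    (hG : ∀ i j, ContMDiffOn I 𝓘(ℝ, ℝ) ∞ (fun x ↦ G x i j) U) :
    ContMDiffOn I 𝓘(ℝ, ℝ) ∞ (fun x ↦ (G x).det) U := by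
  simp only [Matrix.det_apply']
  exact contMDiffOn_finsetSum fun σ _ ↦ contMDiffOn_const.mul
    (contMDiffOn_finsetProd fun i _ ↦ hG _ _)

/-- A vector field is smooth if its inner products with smooth fields are. -/
theorem smoothField_of_inner (g : ContMDiffRiemannianMetric I ∞ E (TangentSpace I : M → Type _))
    {U : Set M} (hU : IsOpen U) {W : Π x : M, TangentSpace I x}
    (hW : ∀ O ⊆ U, IsOpen O → ∀ Z : Π x : M, TangentSpace I x, SmoothField O Z →
      ContMDiffOn I 𝓘(ℝ, ℝ) ∞ (fun x ↦ g.inner x (W x) (Z x)) O) : SmoothField U W := by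
  classical
  intro x₀ hx₀
  let e := trivializationAt E (TangentSpace I : M → Type _) x₀
  have hxe : x₀ ∈ e.baseSet := FiberBundle.mem_baseSet_trivializationAt E (TangentSpace I) x₀
  let b := Module.finBasis ℝ E
  let s := e.localFrame b
  let c := e.localFrameCoeff I b
  let O := U ∩ e.baseSet
  have hO : IsOpen O := hU.inter e.open_baseSet
  have hs : ∀ i, SmoothField O (s i) := fun i ↦
    (e.contMDiffOn_localFrame_baseSet ∞ b i).mono inter_subset_right
  let G : M → Matrix _ _ ℝ := fun x ↦ Matrix.of fun i j ↦ g.inner x (s j x) (s i x)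
  have hG : ∀ i j, ContMDiffOn I 𝓘(ℝ, ℝ) ∞ (fun x ↦ G x i j) O := fun i j ↦
    contMDiffOn_inner g (hs j) (hs i)
  have hsum : ∀ x ∈ O, W x = ∑ j, c j x (W x) • s j x := fun x hx ↦
    Trivialization.eq_sum_localFrameCoeff_smul hx.2
  have hmul : ∀ x ∈ O, (G x).mulVec (fun j ↦ c j x (W x)) = fun i ↦ g.inner x (W x) (s i x) := by
    intro x hx
    funext i
    conv_rhs => rw [hsum x hx, map_sum]
    simp [Matrix.mulVec, dotProduct, G, mul_comm]
  have hdet : ∀ x ∈ O, (G x).det ≠ 0 := by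
    intro x hx h
    obtain ⟨v, hv, h0⟩ := Matrix.exists_mulVec_eq_zero_iff.2 h
    set u : TangentSpace I x := ∑ j, v j • s j x with hu
    have h1 : g.inner x u u = v ⬝ᵥ (G x).mulVec v := by
      rw [hu]
      simp [Matrix.mulVec, dotProduct, G, Finset.mul_sum]
      refine Finset.sum_congr rfl fun p _ ↦ Finset.sum_congr rfl fun q _ ↦ ?_
      ring
    rw [h0, dotProduct_zero] at h1
    have h2 : u = 0 := by
      by_contra h
      exact (g.pos x u h).ne' h1
    have hli : LinearIndependent ℝ (fun j ↦ s j x) :=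
      (e.isLocalFrameOn_localFrame_baseSet I ∞ b).linearIndependent hx.2
    exact hv (funext fun j ↦ Fintype.linearIndependent_iff.1 hli v h2 j)
  -- Cramer's rule recovers the coefficients of `W` from its inner products with the frame.
  have hc : ∀ x ∈ O, ∀ j, c j x (W x) =
      (G x).det⁻¹ * ∑ i, (G x).adjugate j i * g.inner x (W x) (s i x) := by
    intro x hx j
    have h1 : (G x).adjugate.mulVec ((G x).mulVec (fun j ↦ c j x (W x))) =
        (G x).det • fun j ↦ c j x (W x) := by
      rw [Matrix.mulVec_mulVec, Matrix.adjugate_mul, Matrix.smul_mulVec, Matrix.one_mulVec]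
    rw [hmul x hx] at h1
    have h2 := congrFun h1 j
    simp only [Matrix.mulVec, dotProduct, Pi.smul_apply, smul_eq_mul] at h2
    rw [h2, inv_mul_cancel_left₀ (hdet x hx)]
  have hfin : SmoothField O W := by
    refine (contMDiffOn_iff_localFrameCoeff b hO inter_subset_right).2 fun j ↦ ?_
    refine ContMDiffOn.congr (f := fun x ↦ (G x).det⁻¹ *
      ∑ i, (G x).adjugate j i * g.inner x (W x) (s i x)) ?_ fun x hx ↦ hc x hx j
    refine ((contMDiffOn_det hG).inv₀ hdet).mul (contMDiffOn_finsetSum fun i _ ↦ ContMDiffOn.mul ?_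
      (hW O inter_subset_left hO _ (hs i)))
    simp only [Matrix.adjugate_apply]
    refine contMDiffOn_det fun p q ↦ ?_
    simp only [Matrix.updateRow_apply]
    split_ifs
    · exact contMDiffOn_const
    · exact hG p q
  exact ((hfin x₀ ⟨hx₀, hxe⟩).contMDiffAt (hO.mem_nhds ⟨hx₀, hxe⟩)).contMDiffWithinAt

theorem IsLeviCivita.dirDeriv_inner (h : IsLeviCivita g cov) {x : M}
    {Y Z : Π x : M, TangentSpace I x} (hY : MDiffAt (T% Y) x) (hZ : MDiffAt (T% Z) x)
    (u : TangentSpace I x) :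
    dirDeriv (fun y ↦ g.inner y (Y y) (Z y)) u =
      g.inner x (cov Y x u) (Z x) + g.inner x (Y x) (cov Z x u) :=
  h.1 x Y Z hY hZ u

/-- The Koszul formula. -/
theorem IsLeviCivita.koszul (h : IsLeviCivita g cov) {x : M} {X Y Z : Π x : M, TangentSpace I x}
    (hX : MDiffAt (T% X) x) (hY : MDiffAt (T% Y) x) (hZ : MDiffAt (T% Z) x) :
    g.inner x (cov Y x (X x)) (Z x) = (1 / 2) * (
      dirDeriv (fun y ↦ g.inner y (Y y) (Z y)) (X x) +
      dirDeriv (fun y ↦ g.inner y (X y) (Z y)) (Y x) -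
      dirDeriv (fun y ↦ g.inner y (X y) (Y y)) (Z x) +
      g.inner x (mlieBracket I X Y x) (Z x) - g.inner x (mlieBracket I X Z x) (Y x) -
      g.inner x (mlieBracket I Y Z x) (X x)) := by
  have : CompleteSpace E := FiniteDimensional.complete ℝ E
  have ht := fun {P Q : Π x : M, TangentSpace I x} (hP : MDiffAt (T% P) x) (hQ : MDiffAt (T% Q) x) ↦
    cov.torsion_eq_zero_iff.1 h.2 hP hQ
  rw [h.dirDeriv_inner hY hZ, h.dirDeriv_inner hX hZ, h.dirDeriv_inner hX hY,
    ← ht hX hY, ← ht hX hZ, ← ht hY hZ]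
  simp only [map_sub, sub_apply]
  rw [g.symm x (Y x) (cov Z x (X x)), g.symm x (X x) (cov Z x (Y x)),
    g.symm x (X x) (cov Y x (Z x))]
  ring

theorem IsLeviCivita.isSmoothConnection (h : IsLeviCivita g cov) : IsSmoothConnection cov := by
  intro U hU Y X hY hX
  refine smoothField_of_inner g hU fun O hOU hO Z hZ ↦ ?_
  replace hX : SmoothField O X := ContMDiffOn.mono hX hOU
  replace hY : SmoothField O Y := ContMDiffOn.mono hY hOU
  refine ContMDiffOn.congr ?_ fun x hx ↦ h.koszul (hX.mdifferentiableAt hO hx)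
    (hY.mdifferentiableAt hO hx) (hZ.mdifferentiableAt hO hx)
  refine contMDiffOn_const.mul (ContMDiffOn.sub (ContMDiffOn.sub (ContMDiffOn.add
    (ContMDiffOn.sub (ContMDiffOn.add ?_ ?_) ?_) ?_) ?_) ?_)
  · exact contMDiffOn_dirDeriv hO (contMDiffOn_inner g hY hZ) hX
  · exact contMDiffOn_dirDeriv hO (contMDiffOn_inner g hX hZ) hY
  · exact contMDiffOn_dirDeriv hO (contMDiffOn_inner g hX hY) hZ
  · exact contMDiffOn_inner g (hX.mlieBracket hO hY) hZ
  · exact contMDiffOn_inner g (hX.mlieBracket hO hZ) hY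
  · exact contMDiffOn_inner g (hY.mlieBracket hO hZ) hX

end LeviCivita

/-! ### Curvature of a torsion-free connection that is flat on a distribution -/

section Curvature

open VectorField

variable {E : Type*} [NormedAddCommGroup E] [NormedSpace ℝ E] [FiniteDimensional ℝ E]
  {H : Type*} [TopologicalSpace H] {I : ModelWithCorners ℝ E H}
  {M : Type*} [TopologicalSpace M] [ChartedSpace H M] [IsManifold I ∞ M]
  {cov : CovariantDerivative I E (TangentSpace I : M → Type _)}

theorem curvature_swap (X Y Z : Π x : M, TangentSpace I x) (x : M) :
    curvature cov X Y Z x = -curvature cov Y X Z x := by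
  rw [curvature, curvature, mlieBracket_swap_apply, map_neg]
  abel

theorem jacobi_mlieBracket {U : Set M} (hU : IsOpen U) {X Y Z : Π x : M, TangentSpace I x}
    (hX : SmoothField U X) (hY : SmoothField U Y) (hZ : SmoothField U Z) {x : M} (hx : x ∈ U) :
    mlieBracket I X (mlieBracket I Y Z) x + mlieBracket I Y (mlieBracket I Z X) x +
      mlieBracket I Z (mlieBracket I X Y) x = 0 := by
  have : CompleteSpace E := FiniteDimensional.complete ℝ E
  have : IsManifold I (minSmoothness ℝ 3) M := by
    rw [minSmoothness_of_isRCLikeNormedField]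
    infer_instance
  have hs : ∀ {W : Π x : M, TangentSpace I x}, SmoothField U W →
      CMDiffAt (minSmoothness ℝ 2) (T% W) x := fun hW ↦ by
    rw [minSmoothness_of_isRCLikeNormedField]
    exact ((hW x hx).contMDiffAt (hU.mem_nhds hx)).of_le (by simpa using ENat.LEInfty.out)
  rw [leibniz_identity_mlieBracket_apply (hs hX) (hs hY) (hs hZ),
    mlieBracket_swap_apply (V := mlieBracket I X Y), mlieBracket_swap (V := Z) (W := X)]
  have h := mlieBracket_const_smul_right (I := I) (V := Y) (c := (-1 : ℝ))
    ((hX.mlieBracket hU hZ).mdifferentiableAt hU hx)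
  rw [neg_one_smul, neg_one_smul] at h
  rw [h]
  abel

/-- The first Bianchi identity. -/
theorem curvature_cyclic (hs : IsSmoothConnection cov) (hcov : cov.torsion = 0) {U : Set M}
    (hU : IsOpen U) {X Y Z : Π x : M, TangentSpace I x} (hX : SmoothField U X)
    (hY : SmoothField U Y) (hZ : SmoothField U Z) {x : M} (hx : x ∈ U) :
    curvature cov X Y Z x + curvature cov Y Z X x + curvature cov Z X Y x = 0 := by
  have : CompleteSpace E := FiniteDimensional.complete ℝ E
  have ht : ∀ {P Q : Π x : M, TangentSpace I x} {y : M}, SmoothField U P → SmoothField U Q →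
      y ∈ U → cov Q y (P y) - cov P y (Q y) = mlieBracket I P Q y := fun hP hQ hy ↦
    cov.torsion_eq_zero_iff.1 hcov (hP.mdifferentiableAt hU hy) (hQ.mdifferentiableAt hU hy)
  have hd : ∀ {P Q : Π x : M, TangentSpace I x}, SmoothField U P → SmoothField U Q →
      SmoothField U fun y ↦ cov Q y (P y) := fun hP hQ ↦ hs U hU _ _ hQ hP
  have key : ∀ {P Q S : Π x : M, TangentSpace I x}, SmoothField U P → SmoothField U Q →
      SmoothField U S → cov (fun y ↦ cov S y (Q y)) x (P x) - cov (fun y ↦ cov Q y (S y)) x (P x) =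
        cov P x (mlieBracket I Q S x) + mlieBracket I P (mlieBracket I Q S) x := by
    intro P Q S hP hQ hS
    have hb := hQ.mlieBracket hU hS
    have h1 : cov (fun y ↦ cov S y (Q y)) x =
        cov ((fun y ↦ cov Q y (S y)) + mlieBracket I Q S) x :=
      cov.isCovariantDerivativeOnUniv.mono (subset_univ U) |>.congr_of_eqOn
        ((hd hQ hS).mdifferentiableAt hU hx)
        (mdifferentiableAt_add_section ((hd hS hQ).mdifferentiableAt hU hx)
          (hb.mdifferentiableAt hU hx))
        (hU.mem_nhds hx) fun y hy ↦ by
          rw [Pi.add_apply, ← ht hQ hS hy, add_sub_cancel]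
    rw [h1, cov.isCovariantDerivativeOnUniv.add ((hd hS hQ).mdifferentiableAt hU hx)
      (hb.mdifferentiableAt hU hx), add_apply, add_sub_cancel_left, ← ht hP hb hx]
    abel
  have h1 := key hX hY hZ
  have h2 := key hY hZ hX
  have h3 := key hZ hX hY
  have hj := jacobi_mlieBracket hU hX hY hZ hx
  rw [← sub_eq_iff_eq_add'] at h1 h2 h3
  rw [← h1, ← h2, ← h3] at hj
  rw [← hj]
  simp only [curvature]
  abel

/-- A torsion-free connection that is flat on `B` has `R(X, Y) Z = 0` at `x` if one of `X`, `Y` lies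
in `B` at `x`, or if `Z` vanishes at `x`. The last case follows from the first two by the Bianchi
identity, as the zero vector lies in `B`. -/
theorem IsFlatOn.curvature_eq_zero {B : ∀ x : M, Submodule ℝ (TangentSpace I x)}
    (hflat : IsFlatOn cov B) (hs : IsSmoothConnection cov) (hcov : cov.torsion = 0) {U : Set M}
    (hU : IsOpen U) {X Y Z : Π x : M, TangentSpace I x} (hX : SmoothField U X)
    (hY : SmoothField U Y) (hZ : SmoothField U Z) {x : M} (hx : x ∈ U)
    (h : X x ∈ B x ∨ Y x ∈ B x ∨ Z x = 0) : curvature cov X Y Z x = 0 := by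
  rcases h with h | h | h
  · exact hflat U hU X Y Z hX hY hZ x hx h
  · rw [curvature_swap, hflat U hU Y X Z hY hX hZ x hx h, neg_zero]
  · have hB : Z x ∈ B x := h ▸ (B x).zero_mem
    have h1 := curvature_cyclic hs hcov hU hX hY hZ hx
    rwa [curvature_swap Y Z, hflat U hU Z Y X hZ hY hX x hx hB,
      hflat U hU Z X Y hZ hX hY x hx hB, neg_zero, add_zero, add_zero] at h1

end Curvature

/-! ### The graded Leibniz rule -/

section Leibniz

variable {E : Type*} [NormedAddCommGroup E] [NormedSpace ℝ E] [FiniteDimensional ℝ E]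
  {H : Type*} [TopologicalSpace H] {I : ModelWithCorners ℝ E H}
  {M : Type*} [TopologicalSpace M] [ChartedSpace H M] [IsManifold I ∞ M]
  {F : Type*} [NormedAddCommGroup F] [NormedSpace ℝ F]
  {V : M → Type*} [TopologicalSpace (TotalSpace F V)]
  [∀ x, AddCommGroup (V x)] [∀ x, Module ℝ (V x)] [∀ x, TopologicalSpace (V x)]
  [∀ x, IsTopologicalAddGroup (V x)] [∀ x, ContinuousSMul ℝ (V x)]
  [FiberBundle F V] [VectorBundle ℝ F V]

theorem covariantDerivative_sum (nab : CovariantDerivative I F V) {ι : Type*} (t : Finset ι)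
    {s : ι → Π x : M, V x} {x : M} (hs : ∀ i, MDiffAt (T% (s i)) x) :
    nab (fun y ↦ ∑ i ∈ t, s i y) x = ∑ i ∈ t, nab (s i) x := by
  classical
  induction t using Finset.induction_on with
  | empty =>
    simp only [Finset.sum_empty]
    exact congrFun nab.zero x
  | insert i t hi ih =>
    have h : (fun y ↦ ∑ j ∈ insert i t, s j y) = s i + fun y ↦ ∑ j ∈ t, s j y :=
      funext fun y ↦ Finset.sum_insert hi
    rw [h, nab.isCovariantDerivativeOnUniv.add (hs i) (.sum_section fun j _ ↦ hs j), ih,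
      Finset.sum_insert hi]

/-- The coordinate derivative is a derivation of the wedge product. -/
theorem coordDeriv_wedge (nab : CovariantDerivative I F V) {k l : ℕ} (a : RForm I M k)
    (α : VForm I F V l) (x : M) (v : TangentSpace I x) :
    coordDeriv nab (wedge a α) x v =
      wedgeAlt (coordDeriv (trivialConnection I M) a x v) (α.1 x) +
        wedgeAlt (a.1 x) (coordDeriv nab α x v) := by
  ext w
  let f : Equiv.Perm (Fin (k + l)) → M → ℝ := fun σ y ↦
    a.1 y fun i ↦ coordExt (w (σ (Fin.castAdd l i))) y
  let s : Equiv.Perm (Fin (k + l)) → Π y : M, V y := fun σ y ↦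
    α.1 y fun i ↦ coordExt (w (σ (Fin.natAdd k i))) y
  have hf : ∀ σ, MDifferentiableAt I 𝓘(ℝ, ℝ) (f σ) x := fun σ ↦ mdifferentiableAt_trivial_iff.1
    (mdifferentiableAt_vForm a fun i ↦ mdifferentiableAt_coordExt _)
  have hs : ∀ σ, MDiffAt (T% (s σ)) x := fun σ ↦
    mdifferentiableAt_vForm α fun i ↦ mdifferentiableAt_coordExt _
  have hfs : ∀ σ, MDiffAt (T% (f σ • s σ)) x := fun σ ↦ (hf σ).smul_section (hs σ)
  have hc : ∀ (c : ℝ) σ, MDiffAt (T% (c • (f σ • s σ))) x := fun c σ ↦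
    MDifferentiableAt.smul_const_section (hfs σ)
  set C : ℝ := ((k.factorial : ℝ) * (l.factorial : ℝ))⁻¹ with hC
  have h1 : (fun y ↦ (wedge a α).1 y fun i ↦ coordExt (w i) y) =
      C • fun y ↦ ∑ σ : Equiv.Perm (Fin (k + l)), (((Equiv.Perm.sign σ : ℤ) : ℝ) • (f σ • s σ)) y :=
    funext fun y ↦ wedgeAlt_apply (a.1 y) (α.1 y) _
  have h2 : ∀ σ, nab (f σ • s σ) x v = f σ x • nab (s σ) x v + dirDeriv (f σ) v • s σ x := fun σ ↦
    congrArg (fun L : TangentSpace I x →L[ℝ] V x ↦ L v)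
      (nab.isCovariantDerivativeOnUniv.leibniz (hs σ) (hf σ))
  have h3 : ∀ σ, f σ x = a.1 x fun i ↦ w (σ (Fin.castAdd l i)) := fun σ ↦
    congrArg (a.1 x) (funext fun i ↦ coordExt_self _)
  have h4 : ∀ σ, s σ x = α.1 x fun i ↦ w (σ (Fin.natAdd k i)) := fun σ ↦
    congrArg (α.1 x) (funext fun i ↦ coordExt_self _)
  rw [coordDeriv_apply, h1, nab.isCovariantDerivativeOnUniv.smul_const C
    (.sum_section fun σ _ ↦ hc _ σ), covariantDerivative_sum nab _ fun σ ↦ hc _ σ]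
  rw [AlternatingMap.add_apply, wedgeAlt_apply, wedgeAlt_apply, ← hC, ← smul_add, smul_apply,
    altSum, altSum, ← Finset.sum_add_distrib, sum_apply]
  refine congrArg (C • ·) (Finset.sum_congr rfl fun σ _ ↦ ?_)
  rw [nab.isCovariantDerivativeOnUniv.smul_const _ (hfs σ), smul_apply, h2, h3, h4, ← smul_add]
  exact congrArg _ (add_comm _ _)

/-- The graded Leibniz rule. -/
theorem exteriorDeriv_wedge {nab : CovariantDerivative I F V}
    {d : ∀ k, RForm I M k →ₗ[ℝ] RForm I M (k + 1)}
    {D : ∀ k, VForm I F V k →ₗ[ℝ] VForm I F V (k + 1)} (hd : IsDeRhamDifferential d)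
    (hD : IsExteriorCovariantDerivative nab D) {k l : ℕ} (a : RForm I M k) (α : VForm I F V l)
    (x : M) :
    (D (k + l) (wedge a α)).1 x =
      ((wedge (d k a) α).1 x).domDomCongr (finCongr (Nat.add_right_comm k 1 l)) +
        (-1 : ℝ) ^ k • (wedge a (D l α)).1 x := by
  have hd' : IsExteriorCovariantDerivative (trivialConnection I M) d := hd
  rw [hD.eq_alternatizeUncurryFin, alternatizeUncurryFin_wedgeAlt (a.1 x) (α.1 x)
    (coordDeriv (trivialConnection I M) a x) (coordDeriv nab α x) _ (coordDeriv_wedge nab a α x),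
    ← hd'.eq_alternatizeUncurryFin, ← hD.eq_alternatizeUncurryFin]
  rfl

end Leibniz

/-! ### Nilpotence -/

section Nilpotence

open VectorField

variable {E : Type*} [NormedAddCommGroup E] [NormedSpace ℝ E] [FiniteDimensional ℝ E]
  {H : Type*} [TopologicalSpace H] {I : ModelWithCorners ℝ E H}
  {M : Type*} [TopologicalSpace M] [ChartedSpace H M] [IsManifold I ∞ M]

/-- The exterior covariant derivative on coordinate fields, whose brackets vanish. -/
theorem IsExteriorCovariantDerivative.apply_coordExt
    {cov : CovariantDerivative I E (TangentSpace I : M → Type _)}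
    {D : ∀ k, TForm I M k →ₗ[ℝ] TForm I M (k + 1)} (hD : IsExteriorCovariantDerivative cov D)
    {k : ℕ} (α : TForm I M k) {x : M} (w : Fin (k + 1) → TangentSpace I x) {y : M}
    (hy : y ∈ (chartAt H x).source) :
    (D k α).1 y (fun i ↦ coordExt (w i) y) = ∑ i : Fin (k + 1), (-1 : ℝ) ^ (i : ℕ) •
      cov (fun z ↦ α.1 z fun m ↦ coordExt (w (i.succAbove m)) z) y (coordExt (w i) y) :=
  (hD k α (chartAt H x).source (chartAt H x).open_source (fun i ↦ coordExt (w i))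
    (fun _ ↦ smoothField_coordExt _) y hy).trans (exteriorFormula_coordExt cov α w hy)

/-- The square of the exterior covariant derivative is the wedge product with the curvature, and
the curvature of a connection that is flat on `B` vanishes if one of its arguments lies in `B`; so
the square raises the filtration degree by two. -/
theorem VanishesBelow.exteriorDeriv_exteriorDeriv
    {cov : CovariantDerivative I E (TangentSpace I : M → Type _)}
    {B : ∀ x : M, Submodule ℝ (TangentSpace I x)} (hflat : IsFlatOn cov B)
    (hs : IsSmoothConnection cov) (hcov : cov.torsion = 0)
    {D : ∀ k, TForm I M k →ₗ[ℝ] TForm I M (k + 1)} (hD : IsExteriorCovariantDerivative cov D)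
    {k m : ℕ} {α : TForm I M k} {x : M} (hα : VanishesBelow (B x) m (α.1 x)) :
    VanishesBelow (B x) (m + 2) ((D (k + 1) (D k α)).1 x) := by
  intro v hv
  let O := (chartAt H x).source
  have hO : IsOpen O := (chartAt H x).open_source
  have hx : x ∈ O := mem_chart_source H x
  let X : Fin (k + 2) → Π y : M, TangentSpace I y := fun i ↦ coordExt (v i)
  have hX : ∀ i, SmoothField O (X i) := fun i ↦ smoothField_coordExt _
  have hXx : ∀ i, X i x = v i := fun i ↦ coordExt_self _
  let S : Fin (k + 2) → Fin (k + 1) → Π y : M, TangentSpace I y := fun i j z ↦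
    α.1 z fun p ↦ X (i.succAbove (j.succAbove p)) z
  have hS : ∀ i j, SmoothField O (S i j) := fun i j ↦ α.2 O hO _ fun p ↦ hX _
  let P : Fin (k + 2) → Fin (k + 1) → Π y : M, TangentSpace I y := fun i j z ↦
    cov (S i j) z (X (i.succAbove j) z)
  have hP : ∀ i j, MDiffAt (T% (P i j)) x := fun i j ↦
    SmoothField.mdifferentiableAt hO (hs O hO _ _ (hS i j) (hX _)) hx
  have hcP : ∀ (c : ℝ) i j, MDiffAt (T% (c • P i j)) x := fun c i j ↦
    MDifferentiableAt.smul_const_section (hP i j)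
  have h1 : ∀ i, cov (fun z ↦ (D k α).1 z fun p ↦ X (i.succAbove p) z) x =
      ∑ j : Fin (k + 1), (-1 : ℝ) ^ (j : ℕ) • cov (P i j) x := by
    intro i
    have h2 : cov (fun z ↦ (D k α).1 z fun p ↦ X (i.succAbove p) z) x =
        cov (fun z ↦ ∑ j : Fin (k + 1), ((-1 : ℝ) ^ (j : ℕ) • P i j) z) x :=
      cov.isCovariantDerivativeOnUniv.mono (subset_univ O) |>.congr_of_eqOn
        (mdifferentiableAt_vForm (D k α) fun p ↦ (hX _).mdifferentiableAt hO hx)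
        (.sum_section fun j _ ↦ hcP _ i j) (hO.mem_nhds hx)
        fun y hy ↦ hD.apply_coordExt α (fun p ↦ v (i.succAbove p)) hy
    rw [h2, covariantDerivative_sum cov _ fun j ↦ hcP _ i j]
    exact Finset.sum_congr rfl fun j _ ↦ cov.isCovariantDerivativeOnUniv.smul_const _ (hP i j)
  have h2 := hD.apply_coordExt (D k α) v hx
  have h3 : (fun i ↦ coordExt (v i) x) = v := funext hXx
  rw [h3] at h2
  rw [h2]
  refine Eq.trans (Finset.sum_congr rfl fun i _ ↦ ?_)
    (sum_sum_neg_one_pow_eq_zero (fun i j ↦ cov (P i j) x (X i x)) fun i j hij ↦ ?_)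
  · rw [← Finset.smul_sum]
    refine congrArg _ ?_
    refine (congrArg (fun L : TangentSpace I x →L[ℝ] TangentSpace I x ↦ L (X i x)) (h1 i)).trans ?_
    simp only [sum_apply, smul_apply]
  · -- The difference of the two sides is the curvature `R(X_i, X_{j+1})` on the remaining fields.
    have hi := succ_succAbove_of_le hij
    have hj := castSucc_succAbove_of_le hij
    have hSS : S j.succ i = S i.castSucc j := by
      simp only [S, castSucc_succAbove_succAbove hij]
    have hcurv : curvature cov (X i.castSucc) (X j.succ) (S i.castSucc j) x = 0 := by
      refine hflat.curvature_eq_zero hs hcov hO (hX _) (hX _) (hS _ _) hx ?_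
      rw [hXx, hXx]
      by_cases hvi : v i.castSucc ∈ B x
      · exact Or.inl hvi
      by_cases hvj : v j.succ ∈ B x
      · exact Or.inr (Or.inl hvj)
      refine Or.inr (Or.inr ?_)
      rw [← hj] at hvj
      simp only [S, hXx]
      exact hα _ (ncard_succAbove_succAbove hv hvi hvj)
    rw [curvature, mlieBracket_coordExt _ _ hx, map_zero, sub_zero, sub_eq_zero] at hcurv
    simpa only [P, hi, hj, hSS] using hcurv

theorem vanishesBelow_iter {cov : CovariantDerivative I E (TangentSpace I : M → Type _)}
    {B : ∀ x : M, Submodule ℝ (TangentSpace I x)} (hflat : IsFlatOn cov B)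
    (hs : IsSmoothConnection cov) (hcov : cov.torsion = 0)
    {D : ∀ k, TForm I M k →ₗ[ℝ] TForm I M (k + 1)} (hD : IsExteriorCovariantDerivative cov D)
    {k : ℕ} (α : TForm I M k) (x : M) (j : ℕ) :
    VanishesBelow (B x) (2 * j) ((iter D k (2 * j) α).1 x) := by
  induction j with
  | zero => exact VanishesBelow.zero _ _
  | succ j ih => exact ih.exteriorDeriv_exteriorDeriv hflat hs hcov hD

theorem IsSmoothSubbundle.exists_basis {A : ∀ x : M, Submodule ℝ (TangentSpace I x)} {a : ℕ}
    (hA : IsSmoothSubbundle A a) (x : M) : Nonempty (Module.Basis (Fin a) ℝ (A x)) := by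
  obtain ⟨U, -, hx, s, -, hs⟩ := hA x
  obtain ⟨hli, hspan⟩ := hs x hx
  exact ⟨(Module.Basis.span hli).map (LinearEquiv.ofEq _ _ hspan)⟩

end Nilpotence

end NFlat

end

theorem theorem11 {n : ℕ} {M : Type*} [TopologicalSpace M] [T2Space M]
    [SecondCountableTopology M] [ChartedSpace (EuclideanSpace ℝ (Fin n)) M]
    [IsManifold (𝓡 n) ∞ M]
    (g : ContMDiffRiemannianMetric (𝓡 n) ∞ (EuclideanSpace ℝ (Fin n))
      (TangentSpace (𝓡 n) : M → Type _))
    (cov : CovariantDerivative (𝓡 n) (EuclideanSpace ℝ (Fin n))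
      (TangentSpace (𝓡 n) : M → Type _))
    (hcov : NFlat.IsLeviCivita g cov)
    (A B : ∀ x : M, Submodule ℝ (TangentSpace (𝓡 n) x)) (a b : ℕ)
    (hA : NFlat.IsSmoothSubbundle A a) (hB : NFlat.IsSmoothSubbundle B b)
    (hAB : ∀ x, IsCompl (A x) (B x))
    (horth : ∀ x, ∀ u ∈ A x, ∀ v ∈ B x, g.inner x u v = 0)
    (hflat : NFlat.IsFlatOn cov B)
    (N : ℕ) (hN : 1 ≤ N) (haN : a ≤ N) :
    (∃! d : ∀ k, NFlat.RForm (𝓡 n) M k →ₗ[ℝ] NFlat.RForm (𝓡 n) M (k + 1),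
      NFlat.IsDeRhamDifferential d) ∧
    (∃! D : ∀ k, NFlat.TForm (𝓡 n) M k →ₗ[ℝ] NFlat.TForm (𝓡 n) M (k + 1),
      NFlat.IsExteriorCovariantDerivative cov D) ∧
    ∀ (d : ∀ k, NFlat.RForm (𝓡 n) M k →ₗ[ℝ] NFlat.RForm (𝓡 n) M (k + 1))
      (D : ∀ k, NFlat.TForm (𝓡 n) M k →ₗ[ℝ] NFlat.TForm (𝓡 n) M (k + 1)),
      NFlat.IsDeRhamDifferential d → NFlat.IsExteriorCovariantDerivative cov D →
        NFlat.IsNDGModule d D (2 * N) := by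

  have hs := hcov.isSmoothConnection
  refine ⟨NFlat.existsUnique_isExteriorCovariantDerivative
    NFlat.isSmoothConnection_trivialConnection hcov.2,
    NFlat.existsUnique_isExteriorCovariantDerivative hs hcov.2, fun d D hd hD ↦ ?_⟩
  refine ⟨fun l α x ↦ NFlat.wedgeAlt_constOfIsEmpty _, fun j k l a b α x ↦
    NFlat.wedgeAlt_assoc _ _ _, fun k l a α x ↦ NFlat.exteriorDeriv_wedge hd hD a α x,
    fun k ↦ LinearMap.ext fun α ↦ Subtype.ext (funext fun x ↦ ?_)⟩
  obtain ⟨eA⟩ := hA.exists_basis x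
  obtain ⟨eB⟩ := hB.exists_basis x
  -- A nonzero value needs `2 * N` arguments outside `B`, but `A` has rank `a ≤ N < 2 * N`.
  exact (NFlat.vanishesBelow_iter hflat hs hcov.2 hD α x N).eq_zero (hAB x) eA eB (by omega)
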